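/- Let $d\in\mathbb N$ and let $A\in M_d(\{0,1\})$ be aperiodic, i.e. some power $A^N$ with $N\ge 1$ has only strictly positive entries. Let $\mathcal O_A$ be the Cuntz–Krieger algebra of $A$, i.e. the universal unital $C^*$-algebra generated by partial isometries $s_1,\dots,s_d$ with $\sum_i s_is_i^*=1$ and $s_i^*s_i=\sum_j A_{ij}s_js_j^*$ for all $i$. Let $\Lambda_A=\{(x_k)_{k}\in\{1,\dots,d\}^{\mathbb N}: A_{x_kx_{k+1}}=1 \text{ for all } k\}$ be the one-sided Markov subshift, with first coordinate denoted $x_1$, and regard $C(\Lambda_A)$ (complex-valued continuous functions) as a $C^*$-subalgebra of $\mathcal O_A$ by identifying the indicator function of each cylinder $\{x: x_1=i_1,\dots,x_r=i_r\}$ with the projection $s_{i_1}\cdots s_{i_r}(s_{i_1}\cdots s_{i_r})^*$. Let $a\in C(\Lambda_A)$ be self-adjoint and $\beta\in\mathbb R$. Let $\alpha^{\beta,a}=(\alpha^{\beta,a}_t)_{t\in\mathbb R}$ be the one-parameter automorphism group of $\mathcal O_A$ with $\alpha^{\beta,a}_t(s_i)=e^{it(\beta-a)}s_i$ for $i=1,\dots,d$.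 A state $\omega$ of $\mathcal O_A$ is an $(\alpha^{\beta,a},1)$-KMS state if for all $x,y\in\mathcal O_A$ there is a bounded continuous function $F$ on $\{z\in\mathbb C: 0\le \operatorname{Im} z\le 1\}$, analytic in the interior, with $F(t)=\omega(x\,\alpha^{\beta,a}_t(y))$ and $F(t+i)=\omega(\alpha^{\beta,a}_t(y)\,x)$ for all $t\in\mathbb R$. Let $\mathcal L_a$ be the Ruelle transfer operator on $C(\Lambda_A)$, $$(\mathcal L_a f)(x)=\sum_{i:\,A_{i x_1}=1} e^{a(ix)}f(ix),$$ and $\mathcal L_a^*$ its Banach space adjoint. Then restriction $\omega\mapsto\mu:=\omega|_{C(\Lambda_A)}$ (restricted states being identified with Borel probability measures on $\Lambda_A$) maps the set of $(\alpha^{\beta,a},1)$-KMS states of $\mathcal O_A$ into, and onto, the set of Borel probability measures $\mu$ on $\Lambda_A$ with $\mathcal L_a^*\mu=e^\beta\mu$, that is, with $\int \mathcal L_a f\,d\mu=e^\beta\int f\,d\mu$ for all $f\in C(\Lambda_A)$. If in addition $\operatorname{var}_0(a):=\max a-\min a<\log r(A)$, where $r(A)$ is the spectral radius of $A$, then this map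 is a bijection. -/

import Mathlib

noncomputable section

namespace CuntzKrieger

/-! ### The Cuntz–Krieger relations -/

/-- A Cuntz–Krieger family for `A`: partial isometries `s i` in a unital star-ring with
`∑ i, s i (s i)* = 1` and `(s i)* (s i) = ∑ j, A i j s j (s j)*`. -/
structure IsCKFamily {d : ℕ} (A : Matrix (Fin d) (Fin d) ℕ) {B : Type*} [Ring B] [StarRing B]
    (s : Fin d → B) : Prop where
  partial_isometry : ∀ i, s i * star (s i) * s i = s i
  sum_range : ∑ i, s i * star (s i) = 1
  source : ∀ i, star (s i) * s i = ∑ j, A i j • (s j * star (s j))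

/-! ### The free unital star-algebra on `d` generators -/

/-- The free unital complex star-algebra on `d` generators: noncommutative polynomials in the
letters `(i, false)` (the `i`-th generator) and `(i, true)` (its adjoint). -/
def FreeStarAlgebra (d : ℕ) : Type := MonoidAlgebra ℂ (FreeMonoid (Fin d × Bool))

namespace FreeStarAlgebra

variable {d : ℕ}

instance : Ring (FreeStarAlgebra d) :=
  inferInstanceAs (Ring (MonoidAlgebra ℂ (FreeMonoid (Fin d × Bool))))

instance : Algebra ℂ (FreeStarAlgebra d) :=
  inferInstanceAs (Algebra ℂ (MonoidAlgebra ℂ (FreeMonoid (Fin d × Bool))))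

/-- The letter `p`, as an element of the free star-algebra. -/
def letter (p : Fin d × Bool) : FreeStarAlgebra d :=
  MonoidAlgebra.of ℂ (FreeMonoid (Fin d × Bool)) (FreeMonoid.of p)

/-- The `i`-th free generator. -/
def gen (i : Fin d) : FreeStarAlgebra d := letter (i, false)

/-- The unital algebra map with prescribed values on the letters. -/
def liftAlg {B : Type*} [Ring B] [Algebra ℂ B] (g : Fin d × Bool → B) :
    FreeStarAlgebra d →ₐ[ℂ] B :=
  MonoidAlgebra.lift ℂ B (FreeMonoid (Fin d × Bool)) (FreeMonoid.lift g)

theorem liftAlg_letter {B : Type*} [Ring B] [Algebra ℂ B] (g : Fin d × Bool → B)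
    (p : Fin d × Bool) : liftAlg g (letter p) = g p := by
  unfold liftAlg letter
  erw [MonoidAlgebra.lift_of]
  simp

theorem ringHom_ext {B : Type*} [Ring B] {f g : FreeStarAlgebra d →+* B}
    (hc : ∀ c : ℂ, f (algebraMap ℂ _ c) = g (algebraMap ℂ _ c))
    (hl : ∀ p, f (letter p) = g (letter p)) : f = g := by
  apply MonoidAlgebra.ringHom_ext'
  · ext c
    exact hc c
  · apply FreeMonoid.hom_eq
    exact hl

theorem induction {motive : FreeStarAlgebra d → Prop}
    (hc : ∀ c : ℂ, motive (algebraMap ℂ _ c)) (hl : ∀ p, motive (letter p))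
    (hadd : ∀ x y, motive x → motive y → motive (x + y))
    (hmul : ∀ x y, motive x → motive y → motive (x * y)) (x : FreeStarAlgebra d) : motive x := by
  refine MonoidAlgebra.induction_on (motive := motive) x ?_ hadd ?_
  · intro w
    induction w using FreeMonoid.inductionOn' with
    | one => simpa using! hc 1
    | of_mul p w ih => rw [map_mul]; exact hmul _ _ (hl p) ih
  · intro r y hy
    rw [Algebra.smul_def]
    exact hmul _ _ (hc r) hy

/-- The involution as a ring homomorphism to the opposite ring: it conjugates scalars, reverses
words and exchanges each generator with its adjoint. -/
def starAux : FreeStarAlgebra d →+* (FreeStarAlgebra d)ᵐᵒᵖ :=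
  MonoidAlgebra.liftNCRingHom
    ((algebraMap ℂ (FreeStarAlgebra d)ᵐᵒᵖ).comp (starRingEnd ℂ))
    (FreeMonoid.lift fun p => MulOpposite.op (letter (p.1, !p.2)))
    (fun c _ => Algebra.commutes (starRingEnd ℂ c) _)

theorem starAux_letter (p : Fin d × Bool) :
    starAux (letter p) = MulOpposite.op (letter (p.1, !p.2)) := by
  unfold starAux
  refine (MonoidAlgebra.liftNCRingHom_single _ _ _ _ _).trans ?_
  simp

theorem starAux_algebraMap (c : ℂ) :
    starAux (algebraMap ℂ (FreeStarAlgebra d) c) = algebraMap ℂ _ (starRingEnd ℂ c) := by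
  unfold starAux
  refine (MonoidAlgebra.liftNCRingHom_single _ _ _ 1 c).trans ?_
  simp

instance : StarRing (FreeStarAlgebra d) where
  star x := (starAux x).unop
  star_involutive x := by
    induction x using induction with
    | hc c => simp [starAux_algebraMap, MulOpposite.algebraMap_apply]
    | hl p => simp [starAux_letter]
    | hadd x y hx hy => simp [hx, hy]
    | hmul x y hx hy => simp [hx, hy]
  star_mul x y := by simp
  star_add x y := by simp

theorem star_letter (p : Fin d × Bool) : star (letter p) = letter (p.1, !p.2) :=
  congrArg MulOpposite.unop (starAux_letter p)

theorem star_algebraMap (c : ℂ) :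
    star (algebraMap ℂ (FreeStarAlgebra d) c) = algebraMap ℂ _ (star c) :=
  congrArg MulOpposite.unop (starAux_algebraMap c)

instance : StarModule ℂ (FreeStarAlgebra d) where
  star_smul c x := by
    rw [Algebra.smul_def, star_mul, star_algebraMap, Algebra.smul_def, Algebra.commutes]

/-- The unital star-algebra map sending the `i`-th generator to `t i`. -/
def lift {B : Type*} [Ring B] [StarRing B] [Algebra ℂ B] [StarModule ℂ B] (t : Fin d → B) :
    FreeStarAlgebra d →⋆ₐ[ℂ] B where
  __ := liftAlg fun p => if p.2 then star (t p.1) else t p.1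
  map_star' x := by
    change liftAlg _ (star x) = star (liftAlg _ x)
    induction x using induction with
    | hc c =>
      rw [star_algebraMap, AlgHom.commutes, AlgHom.commutes, algebraMap_star_comm]
    | hl p => rcases p with ⟨i, _ | _⟩ <;> simp [star_letter, liftAlg_letter]
    | hadd x y hx hy => simp only [star_add, map_add, hx, hy]
    | hmul x y hx hy => simp only [star_mul, map_mul, hx, hy]

theorem lift_gen {B : Type*} [Ring B] [StarRing B] [Algebra ℂ B] [StarModule ℂ B]
    (t : Fin d → B) (i : Fin d) : lift t (gen i) = t i :=
  (liftAlg_letter _ _).trans (by simp)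

end FreeStarAlgebra

variable {d : ℕ}

/-! ### The universal C*-algebra of the Cuntz–Krieger relations -/

/-- A C*-seminorm on the free star-algebra that vanishes on the Cuntz–Krieger relations for `A`. -/
structure IsCKSeminorm (A : Matrix (Fin d) (Fin d) ℕ) (q : Seminorm ℂ (FreeStarAlgebra d)) :
    Prop where
  mul_le : ∀ x y, q (x * y) ≤ q x * q y
  star_mul_self : ∀ x, q (star x * x) = q x ^ 2
  partial_isometry : ∀ i, q (FreeStarAlgebra.gen i * star (FreeStarAlgebra.gen i) *
    FreeStarAlgebra.gen i - FreeStarAlgebra.gen i) = 0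
  sum_range : q (∑ i, FreeStarAlgebra.gen i * star (FreeStarAlgebra.gen i) - 1) = 0
  source : ∀ i, q (star (FreeStarAlgebra.gen i) * FreeStarAlgebra.gen i -
    ∑ j, A i j • (FreeStarAlgebra.gen j * star (FreeStarAlgebra.gen j))) = 0

namespace IsCKSeminorm
variable {A : Matrix (Fin d) (Fin d) ℕ} {q : Seminorm ℂ (FreeStarAlgebra d)}

theorem star_eq (h : IsCKSeminorm A q) (x : FreeStarAlgebra d) : q (star x) = q x := by
  have key : ∀ y, q y ≤ q (star y) := by
    intro y
    by_cases hy : q y = 0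
    · rw [hy]; exact apply_nonneg q _
    · have h1 := h.mul_le (star y) y
      rw [h.star_mul_self, sq] at h1
      exact le_of_mul_le_mul_right h1 (lt_of_le_of_ne (apply_nonneg q _) (Ne.symm hy))
  exact le_antisymm (by simpa using key (star x)) (key x)

theorem one_le (h : IsCKSeminorm A q) : q 1 ≤ 1 := by
  have := h.star_mul_self 1
  simp only [star_one, mul_one] at this
  nlinarith [sq_nonneg (q 1 - 1)]

theorem congr {x y : FreeStarAlgebra d} (hxy : q (x - y) = 0) : q x = q y := by
  refine le_antisymm ?_ ?_
  · have := map_add_le_add q (x - y) y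
    rw [sub_add_cancel] at this; linarith
  · have := map_add_le_add q (y - x) x
    rw [sub_add_cancel, map_sub_rev] at this; linarith

theorem gen_le (h : IsCKSeminorm A q) (i : Fin d) : q (FreeStarAlgebra.gen i) ≤ 1 := by
  set s := FreeStarAlgebra.gen i
  have h1 : q ((star s * s) * (star s * s)) = q (star s * s) := by
    apply congr
    have h2 : q (star s * (s * star s * s - s)) ≤ 0 := by
      refine (h.mul_le _ _).trans ?_
      rw [h.partial_isometry, mul_zero]
    refine le_antisymm ?_ (apply_nonneg q _)
    have e : star s * s * (star s * s) - star s * s = star s * (s * star s * s - s) := by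
      noncomm_ring
    rw [e]
    exact h2
  have h3 := h.star_mul_self (star s * s)
  rw [star_mul, star_star, h1, h.star_mul_self] at h3
  have h0 : 0 ≤ q s := apply_nonneg q _
  by_contra! hlt
  nlinarith [mul_pos (mul_pos (lt_trans one_pos hlt) (lt_trans one_pos hlt)) (by nlinarith : 0 < q s ^ 2 - 1)]

theorem zero : IsCKSeminorm A (0 : Seminorm ℂ (FreeStarAlgebra d)) := by
  constructor <;> intros <;> simp

end IsCKSeminorm

theorem exists_bound (A : Matrix (Fin d) (Fin d) ℕ) (x : FreeStarAlgebra d) :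
    ∃ C : ℝ, ∀ q, IsCKSeminorm A q → q x ≤ C := by
  induction x using FreeStarAlgebra.induction with
  | hc c =>
    refine ⟨‖c‖, fun q hq => ?_⟩
    rw [Algebra.algebraMap_eq_smul_one, map_smul_eq_mul]
    exact mul_le_of_le_one_right (norm_nonneg _) hq.one_le
  | hl p =>
    refine ⟨1, fun q hq => ?_⟩
    rcases p with ⟨i, _ | _⟩
    · exact hq.gen_le i
    · have := hq.gen_le i
      rw [← hq.star_eq] at this
      exact (congrArg q (FreeStarAlgebra.star_letter (i, false))).symm.le.trans this
  | hadd x y hx hy =>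
    obtain ⟨C, hC⟩ := hx
    obtain ⟨D, hD⟩ := hy
    exact ⟨C + D, fun q hq => (map_add_le_add q x y).trans (add_le_add (hC q hq) (hD q hq))⟩
  | hmul x y hx hy =>
    obtain ⟨C, hC⟩ := hx
    obtain ⟨D, hD⟩ := hy
    exact ⟨C * D, fun q hq => (hq.mul_le x y).trans
      (mul_le_mul (hC q hq) (hD q hq) (apply_nonneg q _) ((apply_nonneg q _).trans (hC q hq)))⟩

/-- The largest C*-seminorm on the free star-algebra that vanishes on the Cuntz–Krieger
relations for `A`. -/
def ckSeminorm (A : Matrix (Fin d) (Fin d) ℕ) : Seminorm ℂ (FreeStarAlgebra d) :=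
  ⨆ q : {q : Seminorm ℂ (FreeStarAlgebra d) // IsCKSeminorm A q}, q.1

section
variable (A : Matrix (Fin d) (Fin d) ℕ)

theorem bddAbove_apply (x : FreeStarAlgebra d) :
    BddAbove (Set.range fun q : {q : Seminorm ℂ (FreeStarAlgebra d) // IsCKSeminorm A q} =>
      q.1 x) := by
  obtain ⟨C, hC⟩ := exists_bound A x
  exact ⟨C, by rintro _ ⟨q, rfl⟩; exact hC q.1 q.2⟩

theorem ckSeminorm_apply (x : FreeStarAlgebra d) : ckSeminorm A x =
    ⨆ q : {q : Seminorm ℂ (FreeStarAlgebra d) // IsCKSeminorm A q}, q.1 x :=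
  Seminorm.iSup_apply (Seminorm.bddAbove_range_iff.2 (bddAbove_apply A))

instance : Nonempty {q : Seminorm ℂ (FreeStarAlgebra d) // IsCKSeminorm A q} :=
  ⟨⟨0, IsCKSeminorm.zero⟩⟩

theorem le_ckSeminorm {q : Seminorm ℂ (FreeStarAlgebra d)} (hq : IsCKSeminorm A q)
    (x : FreeStarAlgebra d) : q x ≤ ckSeminorm A x := by
  rw [ckSeminorm_apply]
  exact le_ciSup (bddAbove_apply A x) ⟨q, hq⟩

theorem ckSeminorm_le {x : FreeStarAlgebra d} {C : ℝ} (h : ∀ q, IsCKSeminorm A q → q x ≤ C) :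
    ckSeminorm A x ≤ C := by
  rw [ckSeminorm_apply]
  exact ciSup_le fun q => h q.1 q.2

theorem isCKSeminorm_ckSeminorm : IsCKSeminorm A (ckSeminorm A) where
  mul_le x y := ckSeminorm_le A fun q hq => (hq.mul_le x y).trans
    (mul_le_mul (le_ckSeminorm A hq x) (le_ckSeminorm A hq y) (apply_nonneg q _)
      (apply_nonneg (ckSeminorm A) _))
  star_mul_self x := by
    refine le_antisymm ?_ ?_
    · refine ckSeminorm_le A fun q hq => ?_
      rw [hq.star_mul_self]
      exact pow_le_pow_left₀ (apply_nonneg q _) (le_ckSeminorm A hq x) 2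
    · have h : ckSeminorm A x ≤ √(ckSeminorm A (star x * x)) := by
        refine ckSeminorm_le A fun q hq => Real.le_sqrt_of_sq_le ?_
        rw [← hq.star_mul_self]
        exact le_ckSeminorm A hq _
      exact (Real.le_sqrt (apply_nonneg (ckSeminorm A) _) (apply_nonneg (ckSeminorm A) _)).1 h
  partial_isometry i := le_antisymm
    (ckSeminorm_le A fun _ hq => (hq.partial_isometry i).le) (apply_nonneg (ckSeminorm A) _)
  sum_range := le_antisymm
    (ckSeminorm_le A fun _ hq => hq.sum_range.le) (apply_nonneg (ckSeminorm A) _)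
  source i := le_antisymm
    (ckSeminorm_le A fun _ hq => (hq.source i).le) (apply_nonneg (ckSeminorm A) _)

end

/-- The free star-algebra, equipped with the seminorm `ckSeminorm A`. -/
def PreCK (_A : Matrix (Fin d) (Fin d) ℕ) : Type := FreeStarAlgebra d

section
variable (A : Matrix (Fin d) (Fin d) ℕ)

instance : Ring (PreCK A) := inferInstanceAs (Ring (FreeStarAlgebra d))
instance : Algebra ℂ (PreCK A) := inferInstanceAs (Algebra ℂ (FreeStarAlgebra d))
instance : StarRing (PreCK A) := inferInstanceAs (StarRing (FreeStarAlgebra d))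
instance : StarModule ℂ (PreCK A) := inferInstanceAs (StarModule ℂ (FreeStarAlgebra d))

instance : SeminormedRing (PreCK A) where
  __ := (inferInstance : Ring (PreCK A))
  __ := (ckSeminorm A).toAddGroupSeminorm.toSeminormedAddCommGroup
  norm_mul_le := (isCKSeminorm_ckSeminorm A).mul_le

theorem PreCK.norm_def (x : PreCK A) : ‖x‖ = ckSeminorm A x := rfl

instance : NormedAlgebra ℂ (PreCK A) where
  norm_smul_le c x := (map_smul_eq_mul (ckSeminorm A) c x).le

instance : NormedStarGroup (PreCK A) where
  norm_star_le x := ((isCKSeminorm_ckSeminorm A).star_eq x).le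

/-- The Cuntz–Krieger algebra `O_A`: the universal C*-algebra generated by a Cuntz–Krieger family
for `A`, i.e. the Hausdorff completion of the free star-algebra in the largest C*-seminorm
vanishing on the relations. It has the universal property `CKAlgebra.lift`, `CKAlgebra.hom_ext`
with respect to all C*-algebras. -/
def CKAlgebra : Type := UniformSpace.Completion (PreCK A)

namespace CKAlgebra

instance : NormedRing (CKAlgebra A) :=
  inferInstanceAs (NormedRing (UniformSpace.Completion (PreCK A)))

instance : CompleteSpace (CKAlgebra A) :=
  inferInstanceAs (CompleteSpace (UniformSpace.Completion (PreCK A)))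

instance : NormedAlgebra ℂ (CKAlgebra A) where
  __ := (inferInstance : Algebra ℂ (UniformSpace.Completion (PreCK A)))
  norm_smul_le := norm_smul_le (α := ℂ) (β := UniformSpace.Completion (PreCK A))

/-- The canonical map with dense range. -/
def of : PreCK A →ₐ[ℂ] CKAlgebra A where
  __ := (UniformSpace.Completion.coeRingHom : PreCK A →+* UniformSpace.Completion (PreCK A))
  commutes' _ := rfl

theorem norm_of (x : PreCK A) : ‖of A x‖ = ‖x‖ := UniformSpace.Completion.norm_coe x

theorem continuous_of : Continuous (of A) := UniformSpace.Completion.continuous_coe (PreCK A)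

theorem denseRange_of : DenseRange (of A) := UniformSpace.Completion.denseRange_coe

theorem uniformContinuous_star : UniformContinuous (star : PreCK A → PreCK A) :=
  uniformContinuous_addMonoidHom_of_continuous
    (f := (starAddEquiv : PreCK A ≃+ PreCK A).toAddMonoidHom) continuous_star

instance : Star (CKAlgebra A) :=
  ⟨UniformSpace.Completion.map (star : PreCK A → PreCK A)⟩

theorem star_of (x : PreCK A) : star (of A x) = of A (star x) :=
  UniformSpace.Completion.map_coe (uniformContinuous_star A) x

theorem continuous_star' : Continuous (star : CKAlgebra A → CKAlgebra A) :=
  UniformSpace.Completion.continuous_map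

instance : StarRing (CKAlgebra A) where
  star_involutive x := by
    refine (denseRange_of A).induction_on (p := fun x => star (star x) = x) x
      (isClosed_eq ((continuous_star' A).comp (continuous_star' A)) continuous_id) ?_
    intro y
    rw [star_of, star_of, star_star]
  star_mul x y := by
    refine (denseRange_of A).induction_on₂ (p := fun x y => star (x * y) = star y * star x)
      (isClosed_eq ((continuous_star' A).comp continuous_mul)
        (((continuous_star' A).comp continuous_snd).mul ((continuous_star' A).comp continuous_fst)))
      ?_ x y
    intro a b
    simp only [← map_mul, star_of, star_mul]
  star_add x y := by
    refine (denseRange_of A).induction_on₂ (p := fun x y => star (x + y) = star x + star y)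
      (isClosed_eq ((continuous_star' A).comp continuous_add)
        (((continuous_star' A).comp continuous_fst).add ((continuous_star' A).comp continuous_snd)))
      ?_ x y
    intro a b
    simp only [← map_add, star_of, star_add]

instance : CStarAlgebra (CKAlgebra A) where
  norm_mul_self_le x := by
    refine (denseRange_of A).induction_on (p := fun x => ‖x‖ * ‖x‖ ≤ ‖star x * x‖) x
      (isClosed_le (by fun_prop) (((continuous_star' A).mul continuous_id).norm)) ?_
    intro y
    rw [star_of, ← map_mul, norm_of, norm_of, PreCK.norm_def, PreCK.norm_def, ← sq]
    exact ((isCKSeminorm_ckSeminorm A).star_mul_self y).ge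
  star_smul c x := by
    refine (denseRange_of A).induction_on (p := fun x => star (c • x) = star c • star x) x
      (isClosed_eq ((continuous_star' A).comp (continuous_const_smul c))
        ((continuous_star' A).const_smul (star c))) ?_
    intro y
    simp only [← map_smul, star_of, star_smul]

/-- The image of a free generator in the seminormed star-algebra. -/
def preGen (i : Fin d) : PreCK A := FreeStarAlgebra.gen i

/-- The canonical generators `s i` of `O_A`. -/
def s (i : Fin d) : CKAlgebra A := of A (preGen A i)

theorem of_eq_of {x y : PreCK A} (h : ckSeminorm A (x - y : PreCK A) = 0) : of A x = of A y := by
  rw [← sub_eq_zero, ← map_sub, ← norm_eq_zero, norm_of]; exact h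

theorem isCKFamily_s : IsCKFamily A (s A) where
  partial_isometry i := by
    simp only [s, star_of, ← map_mul]
    exact of_eq_of A ((isCKSeminorm_ckSeminorm A).partial_isometry i)
  sum_range := by
    simp only [s, star_of, ← map_mul, ← map_sum, ← map_one (of A)]
    exact of_eq_of A (isCKSeminorm_ckSeminorm A).sum_range
  source i := by
    simp only [s, star_of, ← map_mul, ← map_nsmul, ← map_sum]
    exact of_eq_of A ((isCKSeminorm_ckSeminorm A).source i)

variable {A}

/-- The map on the free star-algebra induced by a family. -/
def preLift {B : Type*} [CStarAlgebra B] (t : Fin d → B) : PreCK A →⋆ₐ[ℂ] B :=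
  FreeStarAlgebra.lift t

theorem norm_preLift_le {B : Type*} [CStarAlgebra B] {t : Fin d → B} (ht : IsCKFamily A t)
    (x : PreCK A) : ‖preLift t x‖ ≤ ‖x‖ := by
  have hs : ∀ i, FreeStarAlgebra.lift t (star (FreeStarAlgebra.gen i)) = star (t i) := fun i =>
    (map_star (FreeStarAlgebra.lift t) _).trans (congrArg star (FreeStarAlgebra.lift_gen t i))
  have h : IsCKSeminorm A
      ((normSeminorm ℂ B).comp (FreeStarAlgebra.lift t).toAlgHom.toLinearMap) := by
    constructor
    · intro x y
      change ‖FreeStarAlgebra.lift t (x * y)‖ ≤ ‖FreeStarAlgebra.lift t x‖ * _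
      rw [map_mul]; exact norm_mul_le _ _
    · intro x
      change ‖FreeStarAlgebra.lift t (star x * x)‖ = ‖FreeStarAlgebra.lift t x‖ ^ 2
      rw [map_mul, map_star, CStarRing.norm_star_mul_self, sq]
    · intro i
      change ‖FreeStarAlgebra.lift t _‖ = 0
      simp [FreeStarAlgebra.lift_gen, hs, ht.partial_isometry]
    · change ‖FreeStarAlgebra.lift t _‖ = 0
      simp [FreeStarAlgebra.lift_gen, hs, ht.sum_range]
    · intro i
      change ‖FreeStarAlgebra.lift t _‖ = 0
      simp [FreeStarAlgebra.lift_gen, hs, ht.source]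
  exact le_ckSeminorm A h x

theorem continuous_preLift {B : Type*} [CStarAlgebra B] {t : Fin d → B} (ht : IsCKFamily A t) :
    Continuous (preLift t : PreCK A →⋆ₐ[ℂ] B) :=
  AddMonoidHomClass.continuous_of_bound (preLift t : PreCK A →⋆ₐ[ℂ] B) 1
    fun x => by rw [one_mul]; exact norm_preLift_le ht x

/-- The extension of `preLift` to the completion. -/
def liftRingHom {B : Type*} [CStarAlgebra B] {t : Fin d → B} (ht : IsCKFamily A t) :
    CKAlgebra A →+* B :=
  UniformSpace.Completion.extensionHom
    (preLift t : PreCK A →⋆ₐ[ℂ] B).toAlgHom.toRingHom (continuous_preLift ht)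

theorem liftRingHom_of {B : Type*} [CStarAlgebra B] {t : Fin d → B} (ht : IsCKFamily A t)
    (x : PreCK A) : liftRingHom ht (of A x) = preLift t x :=
  UniformSpace.Completion.extensionHom_coe _ (continuous_preLift ht) x

theorem continuous_liftRingHom {B : Type*} [CStarAlgebra B] {t : Fin d → B}
    (ht : IsCKFamily A t) : Continuous (liftRingHom ht) :=
  UniformSpace.Completion.continuous_extension

/-- The universal property of `O_A`: a Cuntz–Krieger family in a C*-algebra `B` (in any universe)
induces a star-homomorphism `O_A → B`. -/
def lift {B : Type*} [CStarAlgebra B] {t : Fin d → B} (ht : IsCKFamily A t) :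
    CKAlgebra A →⋆ₐ[ℂ] B where
  __ := liftRingHom ht
  commutes' c := (liftRingHom_of ht (algebraMap ℂ (PreCK A) c)).trans
    (AlgHomClass.commutes (preLift t : PreCK A →⋆ₐ[ℂ] B) c)
  map_star' x := by
    refine (denseRange_of A).induction_on
      (p := fun x => liftRingHom ht (star x) = star (liftRingHom ht x)) x
      (isClosed_eq ((continuous_liftRingHom ht).comp (continuous_star' A))
        (continuous_liftRingHom ht).star) ?_
    intro y
    rw [star_of, liftRingHom_of, liftRingHom_of, map_star]

/-- The induced star-homomorphism sends `s i` to `t i`. -/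
theorem lift_s {B : Type*} [CStarAlgebra B] {t : Fin d → B} (ht : IsCKFamily A t) (i : Fin d) :
    lift ht (s A i) = t i :=
  (liftRingHom_of ht (FreeStarAlgebra.gen i)).trans (FreeStarAlgebra.lift_gen t i)

open scoped CStarAlgebra in
/-- Star-homomorphisms on `O_A` are determined by their values on the generators. -/
theorem hom_ext {B : Type*} [CStarAlgebra B] {f g : CKAlgebra A →⋆ₐ[ℂ] B}
    (h : ∀ i, f (s A i) = g (s A i)) : f = g := by
  have hof : ∀ x : PreCK A, f (of A x) = g (of A x) := by
    intro x
    induction x using FreeStarAlgebra.induction with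
    | hc c => exact (congrArg f ((of A).commutes c)).trans ((AlgHomClass.commutes f c).trans
        ((congrArg g ((of A).commutes c)).trans (AlgHomClass.commutes g c)).symm)
    | hl p =>
      rcases p with ⟨i, _ | _⟩
      · exact h i
      · have e : of A (FreeStarAlgebra.letter (i, true)) = star (s A i) :=
          (congrArg (of A) (FreeStarAlgebra.star_letter (i, false)).symm).trans
            (star_of A _).symm
        rw [e, map_star, map_star, h i]
    | hadd x y hx hy =>
      have e : of A (x + y) = of A x + of A y := map_add (of A) x y
      exact (congrArg f e).trans (by rw [map_add, hx, hy, ← map_add, ← e])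
    | hmul x y hx hy =>
      have e : of A (x * y) = of A x * of A y := map_mul (of A) x y
      exact (congrArg f e).trans (by rw [map_mul, hx, hy, ← map_mul, ← e])
  have hf : Continuous f := map_continuous f
  have hg : Continuous g := map_continuous g
  ext x
  exact congrFun ((denseRange_of A).equalizer hf hg (funext hof)) x

end CKAlgebra
end

/-! ### The subshift and the diagonal subalgebra -/

/-- The one-sided Markov subshift `Λ_A` (coordinates indexed from `0`), with the subspace topology
and the subspace σ-algebra of the product; the latter is the Borel σ-algebra. -/
abbrev Subshift (A : Matrix (Fin d) (Fin d) ℕ) : Type :=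
  {x : ℕ → Fin d // ∀ n, A (x n) (x (n + 1)) = 1}

namespace CKAlgebra

section
variable (A : Matrix (Fin d) (Fin d) ℕ)

theorem star_s_mul_s_of_ne {i j : Fin d} (hij : i ≠ j) : star (s A i) * s A j = 0 := by
  let _ := CStarAlgebra.spectralOrder (CKAlgebra A)
  have _ := CStarAlgebra.spectralOrderedRing (CKAlgebra A)
  have hs := isCKFamily_s A
  set p : Fin d → CKAlgebra A := fun i => s A i * star (s A i) with hp
  have hpp : ∀ k, p k * p k = p k := fun k => by
    simp only [hp]
    rw [← mul_assoc, hs.partial_isometry]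
  have hps : ∀ k, star (p k) = p k := fun k => by simp [hp]
  have hsq : ∀ k, p j * p k * p j = star (p k * p j) * (p k * p j) := fun k => by
    rw [star_mul, hps, hps, mul_assoc (p j) (p k) (p k * p j), ← mul_assoc (p k) (p k) (p j),
      hpp, mul_assoc (p j) (p k) (p j)]
  have hsum : ∑ k, p j * p k * p j = p j := by
    rw [← Finset.sum_mul, ← Finset.mul_sum, hs.sum_range, mul_one, hpp]
  have h0 : ∑ k ∈ Finset.univ.erase j, p j * p k * p j = 0 := by
    rw [← Finset.add_sum_erase _ _ (Finset.mem_univ j), hpp, hpp] at hsum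
    exact add_eq_left.mp hsum
  have h1 := (Finset.sum_eq_zero_iff_of_nonneg (fun k _ => by
    rw [hsq]; exact star_mul_self_nonneg _)).1 h0 i (Finset.mem_erase.2 ⟨hij, Finset.mem_univ i⟩)
  rw [hsq, CStarRing.star_mul_self_eq_zero_iff] at h1
  have h2 : star (s A i) = star (s A i) * p i := by
    have := congrArg star (hs.partial_isometry i)
    simpa [hp, mul_assoc] using this.symm
  have h3 : s A j = p j * s A j := (hs.partial_isometry j).symm
  rw [h2, h3, mul_assoc, ← mul_assoc (p i), h1, zero_mul, mul_zero]

/-- `s w = s w₁ ⋯ s wᵣ` for a word `w`. -/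
def word (w : List (Fin d)) : CKAlgebra A := (w.map (s A)).prod

/-- The range projection `s w (s w)*` for a word `w`. -/
def wordProj (w : List (Fin d)) : CKAlgebra A := word A w * star (word A w)

theorem wordProj_nil : wordProj A [] = 1 := by simp [wordProj, word]

theorem wordProj_cons (i : Fin d) (w : List (Fin d)) :
    wordProj A (i :: w) = s A i * wordProj A w * star (s A i) := by
  simp [wordProj, word, mul_assoc]

theorem wordProj_singleton (i : Fin d) : wordProj A [i] = s A i * star (s A i) := by
  simp [wordProj, word]

theorem star_wordProj (w : List (Fin d)) : star (wordProj A w) = wordProj A w := by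
  simp [wordProj]

theorem source_eq (i : Fin d) :
    star (s A i) * s A i = ∑ j, A i j • wordProj A [j] := by
  simp only [wordProj_singleton]
  exact (isCKFamily_s A).source i

theorem singleton_mul_cons (j i : Fin d) (w : List (Fin d)) :
    wordProj A [j] * wordProj A (i :: w) = if j = i then wordProj A (i :: w) else 0 := by
  rw [wordProj_singleton, wordProj_cons]
  split_ifs with h
  · subst h
    rw [← mul_assoc, ← mul_assoc, (isCKFamily_s A).partial_isometry]
  · rw [mul_assoc, ← mul_assoc (star _), ← mul_assoc (star _), star_s_mul_s_of_ne A h]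
    simp

theorem commute_singleton (j : Fin d) (w : List (Fin d)) :
    Commute (wordProj A [j]) (wordProj A w) := by
  rcases w with _ | ⟨i, w⟩
  · rw [wordProj_nil]; exact Commute.one_right _
  · have h := singleton_mul_cons A j i w
    have h' := congrArg star h
    rw [star_mul, star_wordProj, star_wordProj] at h'
    rw [Commute, SemiconjBy, h, h']
    split_ifs <;> simp [star_wordProj]

theorem commute_source (i : Fin d) (w : List (Fin d)) :
    Commute (star (s A i) * s A i) (wordProj A w) := by
  rw [source_eq]
  exact Commute.sum_left _ _ _ fun j _ => (commute_singleton A j w).smul_left _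

theorem cons_mul_cons (i : Fin d) (v w : List (Fin d)) :
    wordProj A (i :: v) * wordProj A (i :: w) =
      s A i * (wordProj A v * wordProj A w) * star (s A i) := by
  have h := (commute_source A i v).eq
  calc wordProj A (i :: v) * wordProj A (i :: w)
      = s A i * (wordProj A v * (star (s A i) * s A i)) * wordProj A w * star (s A i) := by
        simp only [wordProj_cons, mul_assoc]
    _ = (s A i * star (s A i) * s A i) * wordProj A v * wordProj A w * star (s A i) := by
        rw [← h]; simp only [mul_assoc]
    _ = _ := by rw [(isCKFamily_s A).partial_isometry]; simp only [mul_assoc]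

theorem cons_mul_cons_of_ne {i j : Fin d} (hij : i ≠ j) (v w : List (Fin d)) :
    wordProj A (i :: v) * wordProj A (j :: w) = 0 := by
  rw [wordProj_cons, wordProj_cons]
  calc _ = s A i * wordProj A v * (star (s A i) * s A j) * wordProj A w * star (s A j) := by
        simp only [mul_assoc]
    _ = 0 := by rw [star_s_mul_s_of_ne A hij]; simp

theorem commute_wordProj (v w : List (Fin d)) : Commute (wordProj A v) (wordProj A w) := by
  induction v generalizing w with
  | nil => rw [wordProj_nil]; exact Commute.one_left _
  | cons i v ih =>
    rcases w with _ | ⟨j, w⟩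
    · rw [wordProj_nil]; exact Commute.one_right _
    · by_cases hij : i = j
      · subst hij
        rw [Commute, SemiconjBy, cons_mul_cons, cons_mul_cons, (ih w).eq]
      · rw [Commute, SemiconjBy, cons_mul_cons_of_ne A hij, cons_mul_cons_of_ne A (Ne.symm hij)]

theorem wordProj_mul_self (w : List (Fin d)) : wordProj A w * wordProj A w = wordProj A w := by
  induction w with
  | nil => simp [wordProj_nil]
  | cons i w ih => rw [cons_mul_cons, ih, ← wordProj_cons]

theorem wordProj_mul_of_ne {v w : List (Fin d)} (hl : v.length = w.length) (h : v ≠ w) :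
    wordProj A v * wordProj A w = 0 := by
  induction v generalizing w with
  | nil => exact absurd (List.length_eq_zero_iff.1 hl.symm).symm h
  | cons i v ih =>
    rcases w with _ | ⟨j, w⟩
    · simp at hl
    · by_cases hij : i = j
      · subst hij
        rw [cons_mul_cons, ih (by simpa using hl) (by simpa using h)]
        simp
      · exact cons_mul_cons_of_ne A hij _ _

theorem sum_wordProj_append (w : List (Fin d)) :
    ∑ i, wordProj A (w ++ [i]) = wordProj A w := by
  induction w with
  | nil => simpa [wordProj_singleton, wordProj_nil] using (isCKFamily_s A).sum_range
  | cons j w ih =>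
    simp only [List.cons_append, wordProj_cons]
    rw [← Finset.sum_mul, ← Finset.mul_sum, ih]

theorem wordProj_append_pair (w : List (Fin d)) (i j : Fin d) :
    wordProj A (w ++ [i, j]) = A i j • wordProj A (w ++ [i, j]) := by
  induction w with
  | nil =>
    have h : s A i * wordProj A [j] = A i j • (s A i * wordProj A [j]) := by
      calc s A i * wordProj A [j] = s A i * ((star (s A i) * s A i) * wordProj A [j]) := by
            rw [← mul_assoc, ← mul_assoc, (isCKFamily_s A).partial_isometry]
        _ = s A i * (A i j • wordProj A [j]) := by
            rw [source_eq, Finset.sum_mul]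
            congr 1
            rw [Finset.sum_eq_single j]
            · rw [smul_mul_assoc, wordProj_mul_self]
            · intro k _ hk
              rw [smul_mul_assoc, singleton_mul_cons, if_neg hk, smul_zero]
            · simp
        _ = _ := by rw [mul_smul_comm]
    rw [List.nil_append, wordProj_cons, ← smul_mul_assoc, ← h]
  | cons k w ih =>
    rw [List.cons_append, wordProj_cons, ← smul_mul_assoc, ← mul_smul_comm, ← ih]

/-- The C*-subalgebra of `O_A` generated by the range projections of all words, i.e. the canonical
copy of `C(Λ_A)`. -/
def diagonal : StarSubalgebra ℂ (CKAlgebra A) :=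
  (StarAlgebra.adjoin ℂ (Set.range (wordProj A))).topologicalClosure

theorem wordProj_mem_diagonal (w : List (Fin d)) : wordProj A w ∈ diagonal A :=
  StarSubalgebra.le_topologicalClosure _ (StarAlgebra.subset_adjoin ℂ _ ⟨w, rfl⟩)

theorem isClosed_diagonal : IsClosed (diagonal A : Set (CKAlgebra A)) :=
  StarSubalgebra.isClosed_topologicalClosure _

theorem diagonal_mul_comm (x y : diagonal A) : x * y = y * x := by
  have h := StarSubalgebra.topologicalClosure_adjoin_le_centralizer_centralizer ℂ
    (Set.range (wordProj A))
  have hx := h x.2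
  have hy : (y : CKAlgebra A) ∈ StarSubalgebra.centralizer ℂ (Set.range (wordProj A)) := by
    have hle : diagonal A ≤ StarSubalgebra.centralizer ℂ (Set.range (wordProj A)) := by
      refine StarSubalgebra.topologicalClosure_minimal ?_ (Set.isClosed_centralizer _)
      rw [StarAlgebra.adjoin_le_iff]
      rintro _ ⟨v, rfl⟩
      rw [SetLike.mem_coe, StarSubalgebra.mem_centralizer_iff]
      rintro _ ⟨w, rfl⟩
      rw [star_wordProj]
      exact ⟨(commute_wordProj A w v).eq, (commute_wordProj A w v).eq⟩
    exact hle y.2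
  rw [StarSubalgebra.mem_centralizer_iff] at hx
  exact Subtype.ext (hx y hy).1.symm

instance : CommCStarAlgebra (diagonal A) :=
  haveI : IsClosed (diagonal A : Set (CKAlgebra A)) := isClosed_diagonal A
  { (inferInstance : CStarAlgebra (diagonal A)) with
    mul_comm := diagonal_mul_comm A }

/-- The range projection of a word as an element of the diagonal subalgebra. -/
def diagProj (w : List (Fin d)) : diagonal A := ⟨wordProj A w, wordProj_mem_diagonal A w⟩

end

end CKAlgebra

open WeakDual

/-- The word formed by the first `n` coordinates of `x`. -/
def initWord (x : ℕ → Fin d) (n : ℕ) : List (Fin d) := (List.range n).map x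

theorem length_initWord (x : ℕ → Fin d) (n : ℕ) : (initWord x n).length = n := by
  simp [initWord]

theorem initWord_succ (x : ℕ → Fin d) (n : ℕ) :
    initWord x (n + 1) = initWord x n ++ [x n] := by
  simp [initWord, List.range_succ]

namespace CKAlgebra

section
variable (A : Matrix (Fin d) (Fin d) ℕ)

theorem char_diagProj (φ : characterSpace ℂ (diagonal A)) (w : List (Fin d)) :
    φ (diagProj A w) = 0 ∨ φ (diagProj A w) = 1 := by
  have h : diagProj A w * diagProj A w = diagProj A w := Subtype.ext (wordProj_mul_self A w)
  have h' := congrArg φ h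
  rw [map_mul] at h'
  rcases eq_or_ne (φ (diagProj A w)) 0 with h0 | h0
  · exact Or.inl h0
  · exact Or.inr (mul_left_cancel₀ h0 (by rw [h', mul_one]))

theorem exists_next (φ : characterSpace ℂ (diagonal A)) (w : List (Fin d))
    (hw : φ (diagProj A w) = 1) : ∃ i, φ (diagProj A (w ++ [i])) = 1 := by
  by_contra! h
  have h0 : ∀ i, φ (diagProj A (w ++ [i])) = 0 := fun i =>
    (char_diagProj A φ _).resolve_right (h i)
  have e : diagProj A w = ∑ i, diagProj A (w ++ [i]) := by
    apply Subtype.ext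
    rw [AddSubmonoidClass.coe_finsetSum]
    exact (sum_wordProj_append A w).symm
  rw [e, map_sum] at hw
  simp [h0] at hw

theorem char_unique (φ : characterSpace ℂ (diagonal A)) {v w : List (Fin d)}
    (hl : v.length = w.length) (hv : φ (diagProj A v) = 1) (hw : φ (diagProj A w) = 1) :
    v = w := by
  by_contra h
  have e : diagProj A v * diagProj A w = 0 := Subtype.ext (wordProj_mul_of_ne A hl h)
  have := congrArg φ e
  rw [map_mul, hv, hw, map_zero] at this
  simp at this

theorem exists_point (φ : characterSpace ℂ (diagonal A)) :
    ∃ x : Subshift A, ∀ n, φ (diagProj A (initWord x.1 n)) = 1 := by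
  have hnil : φ (diagProj A []) = 1 := by
    have e : diagProj A [] = 1 := Subtype.ext (wordProj_nil A)
    rw [e, map_one]
  obtain ⟨i₀, _⟩ := exists_next A φ [] hnil
  have : Nonempty (Fin d) := ⟨i₀⟩
  choose! next hnext using exists_next A φ
  let W : ℕ → List (Fin d) := fun n => Nat.rec [] (fun _ w => w ++ [next w]) n
  have hW : ∀ n, φ (diagProj A (W n)) = 1 := by
    intro n
    induction n with
    | zero => exact hnil
    | succ n ih => exact hnext _ ih
  have hinit : ∀ n, initWord (fun k => next (W k)) n = W n := by
    intro n
    induction n with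
    | zero => rfl
    | succ n ih => rw [initWord_succ, ih]
  refine ⟨⟨fun k => next (W k), fun n => ?_⟩, fun n => ?_⟩
  · have h1 := hW (n + 2)
    have e : W (n + 2) = W n ++ [next (W n), next (W (n + 1))] := by
      change (W n ++ [next (W n)]) ++ [next (W (n + 1))] = _
      simp
    rw [e] at h1
    have e2 : diagProj A (W n ++ [next (W n), next (W (n + 1))]) =
        A (next (W n)) (next (W (n + 1))) •
          diagProj A (W n ++ [next (W n), next (W (n + 1))]) :=
      Subtype.ext (wordProj_append_pair A _ _ _)
    have h2 := congrArg φ e2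
    rw [map_nsmul, h1, nsmul_eq_mul, mul_one] at h2
    exact_mod_cast h2.symm
  · rw [hinit]; exact hW n

/-- The point of `Λ_A` attached to a character `φ` of the diagonal subalgebra: the one whose
initial words `w` all satisfy `φ (s w (s w)*) = 1`. -/
def charPoint (φ : characterSpace ℂ (diagonal A)) : Subshift A := (exists_point A φ).choose

theorem char_eq_one_iff (φ : characterSpace ℂ (diagonal A)) (w : List (Fin d)) :
    φ (diagProj A w) = 1 ↔ initWord (charPoint A φ).1 w.length = w := by
  have h := (exists_point A φ).choose_spec w.length
  refine ⟨fun hw => char_unique A φ (length_initWord _ _) h hw, fun hw => ?_⟩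
  rw [← hw]; simpa [length_initWord] using! h

theorem continuous_charPoint : Continuous (charPoint A) := by
  refine continuous_induced_rng.2 (continuous_pi fun n => ?_)
  change Continuous fun φ => (charPoint A φ).1 n
  rw [continuous_discrete_rng]
  intro i
  have e : (fun φ => (charPoint A φ).1 n) ⁻¹' {i} =
      ⋃ w ∈ {w : List (Fin d) | w.length = n},
        {φ : characterSpace ℂ (diagonal A) | φ (diagProj A (w ++ [i])) ≠ 0} := by
    ext φ
    simp only [Set.mem_preimage, Set.mem_singleton_iff, Set.mem_iUnion, Set.mem_ofPred_eq,
      exists_prop]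
    constructor
    · intro h
      refine ⟨initWord (charPoint A φ).1 n, length_initWord _ _, ?_⟩
      rw [(char_eq_one_iff A φ _).2]
      · exact one_ne_zero
      · rw [List.length_append, length_initWord, List.length_singleton, initWord_succ, h]
    · rintro ⟨w, hw, h⟩
      have h1 := (char_eq_one_iff A φ _).1 ((char_diagProj A φ _).resolve_left h)
      rw [List.length_append, List.length_singleton, initWord_succ] at h1
      have h2 := (List.append_inj' h1 rfl).2
      rw [hw] at h2
      simpa using h2
  rw [e]
  refine isOpen_biUnion fun w _ => ?_
  exact isOpen_ne_fun (gelfandTransform ℂ (diagonal A) (diagProj A (w ++ [i]))).continuous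
    continuous_const

/-- `charPoint` as a continuous map. -/
def charMap : C(characterSpace ℂ (diagonal A), Subshift A) :=
  ⟨charPoint A, continuous_charPoint A⟩

/-- The canonical unital star-homomorphism of `C(Λ_A)` into `O_A`. It is the one that sends the
indicator function of the cylinder `[w]` to `s w (s w)*` for each word `w`, see
`diagEmbedding_cylinderIndicator`; indicators of cylinders span a dense subspace, so this
determines it. It is built here by Gelfand duality for the diagonal subalgebra. -/
def diagEmbedding : C(Subshift A, ℂ) →⋆ₐ[ℂ] CKAlgebra A :=
  (diagonal A).subtype.comp
    (((gelfandStarTransform (diagonal A)).symm :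
        C(characterSpace ℂ (diagonal A), ℂ) →⋆ₐ[ℂ] diagonal A).comp
      (ContinuousMap.compStarAlgHom' ℂ ℂ (charMap A)))

theorem diagEmbedding_mem (f : C(Subshift A, ℂ)) : diagEmbedding A f ∈ diagonal A :=
  Subtype.property _

/-- The indicator function of the cylinder `[w] = {x | x begins with w}`. -/
def cylinderIndicator (w : List (Fin d)) : C(Subshift A, ℂ) where
  toFun x := if initWord x.1 w.length = w then 1 else 0
  continuous_toFun := by
    have h : Continuous fun x : Subshift A => fun k : Fin w.length => x.1 k :=
      continuous_pi fun k => (continuous_apply _).comp continuous_subtype_val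
    have h2 : Continuous fun y : Fin w.length → Fin d =>
        if List.ofFn y = w then (1 : ℂ) else 0 := continuous_of_discreteTopology
    convert h2.comp h using 2 with x
    have e : initWord x.1 w.length = List.ofFn fun k : Fin w.length => x.1 k := by
      apply List.ext_getElem <;> simp [initWord]
    rw [e]
    rfl

theorem diagEmbedding_cylinderIndicator (w : List (Fin d)) :
    diagEmbedding A (cylinderIndicator A w) = wordProj A w := by
  have h : (cylinderIndicator A w).comp (charMap A) =
      gelfandStarTransform (diagonal A) (diagProj A w) := by
    ext φ
    change (if initWord (charPoint A φ).1 w.length = w then (1 : ℂ) else 0) = φ (diagProj A w)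
    split_ifs with hw
    · exact ((char_eq_one_iff A φ w).2 hw).symm
    · exact ((char_diagProj A φ w).resolve_right fun h => hw ((char_eq_one_iff A φ w).1 h)).symm
  change ((gelfandStarTransform (diagonal A)).symm
    ((cylinderIndicator A w).comp (charMap A)) : CKAlgebra A) = _
  rw [h, StarAlgEquiv.symm_apply_apply]
  rfl

end

variable {A : Matrix (Fin d) (Fin d) ℕ}

/-! ### The one-parameter automorphism group -/

/-- The unitary `U t = exp (i t (β - a))` of `C(Λ_A)`. -/
def phase (a : selfAdjoint C(Subshift A, ℂ)) (β t : ℝ) : C(Subshift A, ℂ) where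
  toFun x := Complex.exp (Complex.I * t * (β - a.1 x))
  continuous_toFun := by fun_prop

theorem star_phase_mul (a : selfAdjoint C(Subshift A, ℂ)) (β t : ℝ) :
    star (phase a β t) * phase a β t = 1 := by
  ext x
  have hx : star (a.1 x) = a.1 x := congrArg (fun f : C(Subshift A, ℂ) => f x) a.2
  change star (Complex.exp _) * Complex.exp _ = 1
  rw [Complex.star_def, ← Complex.exp_conj, ← Complex.exp_add]
  simp only [map_mul, Complex.conj_I, Complex.conj_ofReal, map_sub]
  rw [← Complex.star_def, hx, ← Complex.exp_zero]
  congr 1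
  ring

theorem phase_add (a : selfAdjoint C(Subshift A, ℂ)) (β t u : ℝ) :
    phase a β (t + u) = phase a β t * phase a β u := by
  ext x
  change Complex.exp _ = Complex.exp _ * Complex.exp _
  rw [← Complex.exp_add]
  congr 1
  push_cast
  ring

theorem phase_zero (a : selfAdjoint C(Subshift A, ℂ)) (β : ℝ) : phase a β 0 = 1 := by
  ext x
  change Complex.exp _ = 1
  simp

/-- The unitary `U t`, as an element of `O_A`. -/
def phaseElt (a : selfAdjoint C(Subshift A, ℂ)) (β t : ℝ) : CKAlgebra A :=
  diagEmbedding A (phase a β t)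

theorem star_phaseElt_mul (a : selfAdjoint C(Subshift A, ℂ)) (β t : ℝ) :
    star (phaseElt a β t) * phaseElt a β t = 1 := by
  rw [phaseElt, ← map_star, ← map_mul, star_phase_mul, map_one]

theorem conj_phaseElt (a : selfAdjoint C(Subshift A, ℂ)) (β t : ℝ) {x : CKAlgebra A}
    (hx : x ∈ diagonal A) : phaseElt a β t * x * star (phaseElt a β t) = x := by
  have h1 : phaseElt a β t * star (phaseElt a β t) = 1 := by
    rw [phaseElt, ← map_star, ← map_mul, mul_comm, star_phase_mul, map_one]
  have h2 : phaseElt a β t * x = x * phaseElt a β t := congrArg Subtype.val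
    (diagonal_mul_comm A ⟨_, diagEmbedding_mem A (phase a β t)⟩ ⟨x, hx⟩)
  rw [h2, mul_assoc, h1, mul_one]

theorem isCKFamily_phase (a : selfAdjoint C(Subshift A, ℂ)) (β t : ℝ) :
    IsCKFamily A fun i => phaseElt a β t * s A i := by
  have hr : ∀ i, phaseElt a β t * s A i * star (phaseElt a β t * s A i) =
      s A i * star (s A i) := fun i => by
    have := conj_phaseElt a β t (wordProj_mem_diagonal A [i])
    rw [wordProj_singleton] at this
    rw [star_mul]
    simpa only [mul_assoc] using this
  have hsrc : ∀ i, star (phaseElt a β t * s A i) * (phaseElt a β t * s A i) =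
      star (s A i) * s A i := fun i => by
    rw [star_mul, mul_assoc, ← mul_assoc (star (phaseElt a β t)), star_phaseElt_mul, one_mul]
  refine ⟨fun i => ?_, ?_, fun i => ?_⟩
  · rw [mul_assoc, hsrc, mul_assoc, ← mul_assoc (s A i), (isCKFamily_s A).partial_isometry]
  · simp only [hr]; exact (isCKFamily_s A).sum_range
  · simp only [hr, hsrc]; exact (isCKFamily_s A).source i

/-- The unital star-endomorphism of `O_A` with `s i ↦ U t * s i`. -/
def flowHom (a : selfAdjoint C(Subshift A, ℂ)) (β t : ℝ) : CKAlgebra A →⋆ₐ[ℂ] CKAlgebra A :=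
  lift (isCKFamily_phase a β t)

theorem flowHom_s (a : selfAdjoint C(Subshift A, ℂ)) (β t : ℝ) (i : Fin d) :
    flowHom a β t (s A i) = phaseElt a β t * s A i := lift_s _ i

theorem flowHom_wordProj (a : selfAdjoint C(Subshift A, ℂ)) (β t : ℝ) (w : List (Fin d)) :
    flowHom a β t (wordProj A w) = wordProj A w := by
  induction w with
  | nil => rw [wordProj_nil, map_one]
  | cons i w ih =>
    rw [wordProj_cons, map_mul, map_mul, map_star, flowHom_s, ih, star_mul]
    have := conj_phaseElt a β t (wordProj_mem_diagonal A (i :: w))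
    rw [wordProj_cons] at this
    simpa only [mul_assoc] using this

open scoped CStarAlgebra in
theorem flowHom_of_mem_diagonal (a : selfAdjoint C(Subshift A, ℂ)) (β t : ℝ) {x : CKAlgebra A}
    (hx : x ∈ diagonal A) : flowHom a β t x = x := by
  have hc : Continuous (flowHom a β t) := map_continuous (flowHom a β t)
  have hle : diagonal A ≤ StarAlgHom.equalizer (flowHom a β t) (StarAlgHom.id ℂ (CKAlgebra A)) := by
    refine StarSubalgebra.topologicalClosure_minimal ?_ (isClosed_eq hc continuous_id)
    rw [StarAlgebra.adjoin_le_iff]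
    rintro _ ⟨w, rfl⟩
    exact flowHom_wordProj a β t w
  exact hle hx

theorem flowHom_comp (a : selfAdjoint C(Subshift A, ℂ)) (β t u : ℝ) :
    (flowHom a β t).comp (flowHom a β u) = flowHom a β (t + u) := by
  refine hom_ext fun i => ?_
  rw [StarAlgHom.comp_apply, flowHom_s, map_mul, flowHom_s, flowHom_s,
    flowHom_of_mem_diagonal a β t (x := phaseElt a β u) (diagEmbedding_mem A _), ← mul_assoc]
  congr 1
  rw [phaseElt, phaseElt, phaseElt, ← map_mul, add_comm, phase_add]

theorem flowHom_zero (a : selfAdjoint C(Subshift A, ℂ)) (β : ℝ) :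
    flowHom a β 0 = StarAlgHom.id ℂ (CKAlgebra A) := by
  refine hom_ext fun i => ?_
  rw [flowHom_s, phaseElt, phase_zero, map_one, one_mul]
  rfl

/-- The one-parameter automorphism group `α^{β,a}` of `O_A`, determined by `s i ↦ U t * s i`; see
`flow_s`, `flow_zero` and `flow_add`. -/
def flow (a : selfAdjoint C(Subshift A, ℂ)) (β t : ℝ) : CKAlgebra A ≃⋆ₐ[ℂ] CKAlgebra A :=
  StarAlgEquiv.ofStarAlgHom (flowHom a β t) (flowHom a β (-t))
    (by rw [flowHom_comp, neg_add_cancel, flowHom_zero])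
    (by rw [flowHom_comp, add_neg_cancel, flowHom_zero])

theorem flow_s (a : selfAdjoint C(Subshift A, ℂ)) (β t : ℝ) (i : Fin d) :
    flow a β t (s A i) = diagEmbedding A (phase a β t) * s A i := flowHom_s a β t i

theorem flow_zero (a : selfAdjoint C(Subshift A, ℂ)) (β : ℝ) (x : CKAlgebra A) :
    flow a β 0 x = x := congrArg (fun f : CKAlgebra A →⋆ₐ[ℂ] CKAlgebra A => f x) (flowHom_zero a β)

theorem flow_add (a : selfAdjoint C(Subshift A, ℂ)) (β t u : ℝ) (x : CKAlgebra A) :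
    flow a β (t + u) x = flow a β t (flow a β u x) :=
  congrArg (fun f : CKAlgebra A →⋆ₐ[ℂ] CKAlgebra A => f x) (flowHom_comp a β t u).symm

end CKAlgebra

/-! ### States and the KMS condition -/

open scoped ComplexOrder in
/-- `ω` is a state: a positive linear functional with `ω 1 = 1`. -/
structure IsState {B : Type*} [CStarAlgebra B] (ω : B →L[ℂ] ℂ) : Prop where
  map_one : ω 1 = 1
  nonneg : ∀ x, 0 ≤ ω (star x * x)

/-- `ω` is a KMS state for the dynamics `α` at inverse temperature `b > 0`: for all `x`, `y` there
is a bounded continuous function on the strip `0 ≤ Im z ≤ b`, analytic in its interior, whose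
boundary values are `ω (x α_t(y))` at `t` and `ω (α_t(y) x)` at `t + i b`. -/
structure IsKMSState {B : Type*} [CStarAlgebra B] (α : ℝ → B ≃⋆ₐ[ℂ] B) (b : ℝ)
    (ω : B →L[ℂ] ℂ) : Prop where
  isState : IsState ω
  kms : ∀ x y : B, ∃ F : ℂ → ℂ,
    ContinuousOn F {z | 0 ≤ z.im ∧ z.im ≤ b} ∧
    DifferentiableOn ℂ F {z | 0 < z.im ∧ z.im < b} ∧
    (∃ C, ∀ z, 0 ≤ z.im → z.im ≤ b → ‖F z‖ ≤ C) ∧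
    ∀ t : ℝ, F t = ω (x * α t y) ∧ F (t + b * Complex.I) = ω (α t y * x)

/-! ### The Ruelle transfer operator -/

section
variable {A : Matrix (Fin d) (Fin d) ℕ}

/-- The point `i x₀ x₁ …`, for `A i x₀ = 1`. -/
def prepend (i : Fin d) (x : Subshift A) (h : A i (x.1 0) = 1) : Subshift A :=
  ⟨fun n => Nat.casesOn n i x.1, fun n => by cases n with
    | zero => exact h
    | succ n => exact x.2 n⟩

theorem continuous_branch (i : Fin d) (g : C(Subshift A, ℂ)) : Continuous fun x : Subshift A =>
    if h : A i (x.1 0) = 1 then g (prepend i x h) else 0 := by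
  have h0 : Continuous fun x : Subshift A => x.1 0 :=
    (continuous_apply 0).comp continuous_subtype_val
  have hcl : IsClopen {x : Subshift A | A i (x.1 0) = 1} :=
    (isClopen_discrete {j | A i j = 1}).preimage h0
  rw [continuous_iff_continuousAt]
  intro x
  by_cases hx : A i (x.1 0) = 1
  · have hc : Continuous fun y : {x : Subshift A | A i (x.1 0) = 1} =>
        g (prepend i y.1 y.2) := by
      refine g.continuous.comp (Continuous.subtype_mk (continuous_pi fun n => ?_) _)
      cases n with
      | zero => exact continuous_const
      | succ n =>
        exact (continuous_apply n).comp (continuous_subtype_val.comp continuous_subtype_val)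
    let y : {x : Subshift A | A i (x.1 0) = 1} := ⟨x, hx⟩
    have hemb : Topology.IsOpenEmbedding
        (Subtype.val : {x : Subshift A | A i (x.1 0) = 1} → Subshift A) :=
      hcl.isOpen.isOpenEmbedding_subtypeVal
    refine (hemb.continuousAt_iff (x := y)).1 ?_
    convert hc.continuousAt using 2 with y
    exact dif_pos y.2
  · refine (continuousAt_const (y := (0 : ℂ))).congr ?_
    filter_upwards [hcl.compl.isOpen.mem_nhds hx] with y hy
    have hy' : ¬ A i (y.1 0) = 1 := hy
    rw [dif_neg hy']

/-- The Ruelle transfer operator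
`(L_a f) x = ∑_{i : A i x₀ = 1} exp (a (i x)) f (i x)` on `C(Λ_A)`. -/
def ruelle (a : C(Subshift A, ℂ)) : C(Subshift A, ℂ) →ₗ[ℂ] C(Subshift A, ℂ) where
  toFun f :=
    { toFun := fun x => ∑ i, if h : A i (x.1 0) = 1 then
        Complex.exp (a (prepend i x h)) * f (prepend i x h) else 0
      continuous_toFun := continuous_finsetSum _ fun i _ =>
        continuous_branch i (⟨fun x => Complex.exp (a x), by fun_prop⟩ * f) }
  map_add' f g := by
    ext x
    simp only [ContinuousMap.coe_mk, ContinuousMap.add_apply, ← Finset.sum_add_distrib]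
    refine Finset.sum_congr rfl fun i _ => ?_
    split_ifs <;> ring
  map_smul' c f := by
    ext x
    simp only [ContinuousMap.coe_mk, ContinuousMap.smul_apply, smul_eq_mul, RingHom.id_apply,
      Finset.mul_sum]
    refine Finset.sum_congr rfl fun i _ => ?_
    split_ifs <;> ring

/-- `max a - min a`, for a real-valued function `a` (extrema are attained, by compactness). -/
def var₀ (a : C(Subshift A, ℂ)) : ℝ := (⨆ x, (a x).re) - ⨅ x, (a x).re

/-- The `(α^{β,a}, 1)`-KMS states of `O_A`. -/
def kmsStates (a : selfAdjoint C(Subshift A, ℂ)) (β : ℝ) : Set (CKAlgebra A →L[ℂ] ℂ) :=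
  {ω | IsKMSState (CKAlgebra.flow a β) 1 ω}

/-- The Borel probability measures `μ` on `Λ_A` with `L_a* μ = e^β μ`, where `L_a*` is the Banach
space adjoint of `L_a` and `μ` is regarded as a functional on `C(Λ_A)`. -/
def eigenmeasures (a : selfAdjoint C(Subshift A, ℂ)) (β : ℝ) :
    Set (MeasureTheory.ProbabilityMeasure (Subshift A)) :=
  {μ | ∀ f : C(Subshift A, ℂ),
    ∫ x, ruelle a.1 f x ∂(μ : MeasureTheory.Measure (Subshift A)) =
      (Real.exp β : ℂ) * ∫ x, f x ∂(μ : MeasureTheory.Measure (Subshift A))}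

end

/-- `A` is aperiodic: some positive power of `A` has only positive entries. -/
def IsAperiodic (A : Matrix (Fin d) (Fin d) ℕ) : Prop :=
  ∃ N, 0 < N ∧ ∀ i j, 0 < (A ^ N) i j

/-- The spectral radius `r(A)` of `A`, as a complex matrix. -/
def specRadius (A : Matrix (Fin d) (Fin d) ℕ) : ℝ :=
  (spectralRadius ℂ (A.map (Nat.cast : ℕ → ℂ))).toReal

end CuntzKrieger

end

/-!
Evaluated at `t = 0` on the generators and on the diagonal, the KMS condition reads
`ω (x e^{a-β} s_i) = ω (s_i x)` and `ω (x f) = ω (f x)`. These conformality identities give back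
the whole condition, since the elements satisfying it form a subalgebra, and applied to
`x = (s_i)* f` they say that the restriction of `ω` to the diagonal is an eigenmeasure.

Conversely, `O_A` acts on `ℓ²(Λ_A × ℤ)` by `s_i δ_(x, n) = δ_(ix, n + 1)`, and the diagonal
coefficients of this representation give a conditional expectation `E` onto `C(Λ_A)`; the
`ℤ`-coordinate removes the contribution of periodic points. Then `μ ∘ E` is a conformal state
restricting to `μ`.

Under a conformal state, moving a letter from one end of a word to the other costs a factor
`e^{a-β}`. If `‖e^{a-β}‖ < 1`, this forces `ω` to vanish on nonempty words times functions, so that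
`ω` is determined by its restriction. As `∫ (L_a)^n 1 dμ = e^{nβ}` grows at least like
`e^{n min a} r(A)^n`, we have `log r(A) ≤ β - min a`, and `max a - min a < log r(A)` makes
`max a < β`.
-/

noncomputable section

namespace CuntzKrieger

open Complex Filter Topology Set MeasureTheory
open scoped ComplexConjugate

/-! ### Bounded holomorphic functions on a strip -/

/-- `F` is bounded and continuous on the closed strip `0 ≤ Im z ≤ b` and holomorphic in its
interior: the regularity asked for in the KMS condition. -/
structure IsStripFunction (b : ℝ) (F : ℂ → ℂ) : Prop where
  continuousOn : ContinuousOn F (im ⁻¹' Icc 0 b)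
  differentiableOn : DifferentiableOn ℂ F (im ⁻¹' Ioo 0 b)
  bounded : ∃ C, ∀ z, 0 ≤ z.im → z.im ≤ b → ‖F z‖ ≤ C

theorem isStripFunction_of_differentiable {b C : ℝ} {F : ℂ → ℂ} (hF : Differentiable ℂ F)
    (hC : ∀ z, 0 ≤ z.im → z.im ≤ b → ‖F z‖ ≤ C) : IsStripFunction b F :=
  ⟨hF.continuous.continuousOn, hF.differentiableOn, C, hC⟩

namespace IsStripFunction

variable {b : ℝ} {F G : ℂ → ℂ}

theorem sub (hF : IsStripFunction b F) (hG : IsStripFunction b G) : IsStripFunction b (F - G) where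
  continuousOn := hF.continuousOn.sub hG.continuousOn
  differentiableOn := hF.differentiableOn.sub hG.differentiableOn
  bounded := by
    obtain ⟨C, hC⟩ := hF.bounded
    obtain ⟨D, hD⟩ := hG.bounded
    exact ⟨C + D, fun z h0 hb => norm_sub_le_of_le (hC z h0 hb) (hD z h0 hb)⟩

theorem mul (hF : IsStripFunction b F) (hG : IsStripFunction b G) : IsStripFunction b (F * G) where
  continuousOn := hF.continuousOn.mul hG.continuousOn
  differentiableOn := hF.differentiableOn.mul hG.differentiableOn
  bounded := by
    obtain ⟨C, hC⟩ := hF.bounded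
    obtain ⟨D, hD⟩ := hG.bounded
    exact ⟨C * D, fun z h0 hb => norm_mul_le_of_le (hC z h0 hb) (hD z h0 hb)⟩

theorem norm_le (hF : IsStripFunction b F) (hb : 0 < b) {C : ℝ}
    (h₀ : ∀ z : ℂ, z.im = 0 → ‖F z‖ ≤ C) (h₁ : ∀ z : ℂ, z.im = b → ‖F z‖ ≤ C) {z : ℂ}
    (hz₀ : 0 ≤ z.im) (hz₁ : z.im ≤ b) : ‖F z‖ ≤ C := by
  refine PhragmenLindelof.horizontal_strip
    ⟨hF.differentiableOn, ?_⟩ ⟨0, div_pos Real.pi_pos (sub_pos.2 hb), 0, ?_⟩ h₀ h₁ hz₀ hz₁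
  · rw [closure_preimage_im, closure_Ioo hb.ne]
    exact hF.continuousOn
  · obtain ⟨D, hD⟩ := hF.bounded
    refine Asymptotics.IsBigO.of_bound D ?_
    filter_upwards [mem_inf_of_right (mem_principal_self _)] with w hw
    simpa using hD w hw.1.le hw.2.le

theorem eqOn_zero_of_ofReal (hF : IsStripFunction b F) (hb : 0 < b) (h : ∀ t : ℝ, F t = 0) :
    EqOn F 0 (im ⁻¹' Icc 0 b) := by
  have hreal : ∀ z : ℂ, z.im = 0 → F z = 0 := fun z hz => by
    rw [← h z.re, show (z.re : ℂ) = z from Complex.ext rfl hz.symm]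
  obtain ⟨C, hC⟩ := hF.bounded
  have hC₀ : 0 ≤ C := (norm_nonneg _).trans (hC 0 le_rfl hb.le)
  -- Multiplying by `exp (k (b + i z))`, of modulus `exp (k (b - Im z))`, changes neither bound.
  have hexp : ∀ (k : ℝ) (z : ℂ), ‖exp (k * (b + I * z))‖ = Real.exp (k * (b - z.im)) :=
    fun k z => by simp [norm_exp, sub_eq_add_neg]
  have hdecay : ∀ k : ℝ, 0 ≤ k → ∀ z : ℂ, 0 ≤ z.im → z.im ≤ b →
      Real.exp (k * (b - z.im)) * ‖F z‖ ≤ C := fun k hk z hz₀ hz₁ => by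
    have hK : IsStripFunction b fun z => exp (k * (b + I * z)) :=
      isStripFunction_of_differentiable (C := Real.exp (k * b)) (by fun_prop) fun z hz₀ _ => by
        rw [hexp]; gcongr; linarith
    have := (hK.mul hF).norm_le hb (C := C) (fun z hz => by simp [hreal z hz, hC₀])
      (fun z hz => by
        simpa [hexp, hz] using hC z (by linarith) hz.le) hz₀ hz₁
    simpa [hexp] using this
  have hopen : EqOn F 0 (im ⁻¹' Ico 0 b) := fun z hz => by
    by_contra hne
    have hgrow : Tendsto (fun k : ℝ => Real.exp (k * (b - z.im)) * ‖F z‖) atTop atTop :=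
      (Real.tendsto_exp_atTop.comp (tendsto_id.atTop_mul_const (sub_pos.2 hz.2))).atTop_mul_const
        (norm_pos_iff.2 hne)
    obtain ⟨k, hk, hk₀⟩ := ((hgrow.eventually_gt_atTop C).and (eventually_ge_atTop 0)).exists
    exact hk.not_ge (hdecay k hk₀ z hz.1 hz.2.le)
  refine hopen.of_subset_closure hF.continuousOn continuousOn_const
    (preimage_mono Ico_subset_Icc_self) ?_
  rw [closure_preimage_im, closure_Ico hb.ne]

theorem eqOn_of_ofReal (hF : IsStripFunction b F) (hG : IsStripFunction b G) (hb : 0 < b)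
    (h : ∀ t : ℝ, F t = G t) : EqOn F G (im ⁻¹' Icc 0 b) := fun _ hz =>
  sub_eq_zero.1 ((hF.sub hG).eqOn_zero_of_ofReal hb (fun t => sub_eq_zero.2 (h t)) hz)

theorem of_tendstoUniformlyOn {F : ℕ → ℂ → ℂ} (hF : ∀ n, IsStripFunction b (F n))
    (h : TendstoUniformlyOn F G atTop (im ⁻¹' Icc 0 b)) : IsStripFunction b G where
  continuousOn := h.continuousOn (Frequently.of_forall fun n => (hF n).continuousOn)
  differentiableOn :=
    (h.mono (preimage_mono Ioo_subset_Icc_self)).tendstoLocallyUniformlyOn.differentiableOn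
      (Eventually.of_forall fun n => (hF n).differentiableOn) (isOpen_Ioo.preimage continuous_im)
  bounded := by
    obtain ⟨n, hn⟩ := (Metric.tendstoUniformlyOn_iff.1 h 1 one_pos).exists
    obtain ⟨C, hC⟩ := (hF n).bounded
    refine ⟨C + 1, fun z hz₀ hz₁ => ?_⟩
    calc ‖G z‖ ≤ ‖F n z‖ + ‖G z - F n z‖ := norm_le_norm_add_norm_sub' _ _
      _ ≤ C + 1 := add_le_add (hC z hz₀ hz₁) (by
          rw [← dist_eq_norm]; exact (hn z ⟨hz₀, hz₁⟩).le)

theorem uniformCauchySeqOn {F : ℕ → ℂ → ℂ} (hF : ∀ n, IsStripFunction b (F n)) (hb : 0 < b)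
    (h : UniformCauchySeqOn F atTop (im ⁻¹' {0, b})) :
    UniformCauchySeqOn F atTop (im ⁻¹' Icc 0 b) := by
  rw [Metric.uniformCauchySeqOn_iff] at h ⊢
  intro ε hε
  obtain ⟨N, hN⟩ := h (ε / 2) (half_pos hε)
  refine ⟨N, fun m hm n hn z hz => lt_of_le_of_lt ?_ (half_lt_self hε)⟩
  rw [dist_eq_norm]
  refine ((hF m).sub (hF n)).norm_le hb (fun w hw => ?_) (fun w hw => ?_) hz.1 hz.2
  · exact (dist_eq_norm (F m w) _).symm.trans_le (hN m hm n hn w (.inl hw)).le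
  · exact (dist_eq_norm (F m w) _).symm.trans_le (hN m hm n hn w (.inr hw)).le

theorem exists_tendstoUniformlyOn {F : ℕ → ℂ → ℂ} (hF : ∀ n, IsStripFunction b (F n))
    (hb : 0 < b) (h : UniformCauchySeqOn F atTop (im ⁻¹' {0, b})) :
    ∃ G, IsStripFunction b G ∧ TendstoUniformlyOn F G atTop (im ⁻¹' Icc 0 b) := by
  have hC := uniformCauchySeqOn hF hb h
  have hlim : ∀ z ∈ im ⁻¹' Icc 0 b, Tendsto (F · z) atTop (𝓝 (limUnder atTop (F · z))) :=
    fun z hz => (hC.cauchySeq hz).tendsto_limUnder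
  exact ⟨_, of_tendstoUniformlyOn hF (hC.tendstoUniformlyOn_of_tendsto hlim),
    hC.tendstoUniformlyOn_of_tendsto hlim⟩

end IsStripFunction

/-! ### Analytic elements and the KMS condition -/

section KMS

variable {B : Type*} [CStarAlgebra B] {α : ℝ → B ≃⋆ₐ[ℂ] B} {b : ℝ} {ω : B →L[ℂ] ℂ}

/-- `G` is an entire extension of the orbit `t ↦ α t y` that is bounded on the strip
`0 ≤ Im z ≤ b`; its existence makes `y` an analytic element for the dynamics `α`. -/
structure IsAnalyticExtension (α : ℝ → B ≃⋆ₐ[ℂ] B) (b : ℝ) (y : B) (G : ℂ → B) : Prop where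
  differentiable : Differentiable ℂ G
  bounded : ∃ C, ∀ z : ℂ, 0 ≤ z.im → z.im ≤ b → ‖G z‖ ≤ C
  apply_ofReal : ∀ t : ℝ, G t = α t y

namespace IsAnalyticExtension

variable {x y : B} {G H : ℂ → B}

theorem add (hG : IsAnalyticExtension α b x G) (hH : IsAnalyticExtension α b y H) :
    IsAnalyticExtension α b (x + y) (G + H) where
  differentiable := hG.differentiable.add hH.differentiable
  bounded := by
    obtain ⟨C, hC⟩ := hG.bounded
    obtain ⟨D, hD⟩ := hH.bounded
    exact ⟨C + D, fun z h0 h1 => norm_add_le_of_le (hC z h0 h1) (hD z h0 h1)⟩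
  apply_ofReal t := by rw [Pi.add_apply, hG.apply_ofReal, hH.apply_ofReal, map_add]

theorem mul (hG : IsAnalyticExtension α b x G) (hH : IsAnalyticExtension α b y H) :
    IsAnalyticExtension α b (x * y) (G * H) where
  differentiable := hG.differentiable.mul hH.differentiable
  bounded := by
    obtain ⟨C, hC⟩ := hG.bounded
    obtain ⟨D, hD⟩ := hH.bounded
    exact ⟨C * D, fun z h0 h1 => norm_mul_le_of_le (hC z h0 h1) (hD z h0 h1)⟩
  apply_ofReal t := by rw [Pi.mul_apply, hG.apply_ofReal, hH.apply_ofReal, map_mul]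

theorem smul_one (c : ℂ) : IsAnalyticExtension α b (c • 1) fun _ => c • 1 where
  differentiable := differentiable_const _
  bounded := ⟨_, fun _ _ _ => le_rfl⟩
  apply_ofReal t := by rw [map_smul, map_one]

theorem isStripFunction (hG : IsAnalyticExtension α b y G) (ω : B →L[ℂ] ℂ) (x : B) :
    IsStripFunction b fun z => ω (x * G z) := by
  obtain ⟨C, hC⟩ := hG.bounded
  refine isStripFunction_of_differentiable (C := ‖ω‖ * (‖x‖ * C))
    (ω.differentiable.comp ((differentiable_const x).mul hG.differentiable)) fun z h0 h1 => ?_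
  exact ω.le_opNorm_of_le (norm_mul_le_of_le le_rfl (hC z h0 h1))

end IsAnalyticExtension

theorem IsKMSState.apply_mul_eq (hω : IsKMSState α b ω) (hb : 0 < b) (hα : ∀ x, α 0 x = x)
    {y : B} {G : ℂ → B} (hG : IsAnalyticExtension α b y G) (x : B) :
    ω (x * G (b * I)) = ω (y * x) := by
  obtain ⟨F, hcont, hdiff, hbdd, hF⟩ := hω.kms x y
  have heq := IsStripFunction.eqOn_of_ofReal ⟨hcont, hdiff, hbdd⟩ (hG.isStripFunction ω x) hb
    fun t => by rw [(hF t).1, hG.apply_ofReal]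
  calc ω (x * G (b * I)) = F (b * I) := (heq (by simp [hb.le])).symm
    _ = ω (y * x) := by simpa [hα] using (hF 0).2

variable (α b ω) in
/-- The algebra of analytic elements that satisfy the KMS condition
`ω (x α_{t + i b}(y)) = ω (α_t(y) x)` against every `x`. -/
def kmsSubalgebra : Subalgebra ℂ B where
  carrier := {y | ∃ G, IsAnalyticExtension α b y G ∧
    ∀ (x : B) (t : ℝ), ω (x * G (t + b * I)) = ω (α t y * x)}
  algebraMap_mem' c := by
    rw [Algebra.algebraMap_eq_smul_one]
    refine ⟨_, .smul_one c, fun x t => ?_⟩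
    rw [map_smul, map_one, mul_smul_comm, smul_mul_assoc, mul_one, one_mul]
  add_mem' := by
    rintro y z ⟨G, hG, hG'⟩ ⟨H, hH, hH'⟩
    refine ⟨_, hG.add hH, fun x t => ?_⟩
    rw [Pi.add_apply, mul_add, map_add, hG', hH', map_add, add_mul, map_add]
  mul_mem' := by
    rintro y z ⟨G, hG, hG'⟩ ⟨H, hH, hH'⟩
    refine ⟨_, hG.mul hH, fun x t => ?_⟩
    rw [Pi.mul_apply, ← mul_assoc x, hH', ← mul_assoc (α t z), hG', map_mul (α t), mul_assoc]

theorem uniformCauchySeqOn_boundary {u : ℕ → B} (hu : CauchySeq u) {F : ℕ → ℂ → ℂ} {x : B}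
    (h₀ : ∀ n (t : ℝ), F n t = ω (x * α t (u n)))
    (h₁ : ∀ n (t : ℝ), F n (t + b * I) = ω (α t (u n) * x)) :
    UniformCauchySeqOn F atTop (im ⁻¹' {0, b}) := by
  have hnorm : ∀ (t : ℝ) m n, ‖α t (u m) - α t (u n)‖ ≤ dist (u m) (u n) := fun t m n => by
    rw [← map_sub, StarAlgEquiv.norm_map, dist_eq_norm]
  have hbound : ∀ m n, ∀ z ∈ im ⁻¹' {0, b},
      dist (F m z) (F n z) ≤ ‖ω‖ * ‖x‖ * dist (u m) (u n) := by
    rintro m n z (hz | hz)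
    · rw [show z = (z.re : ℂ) from Complex.ext rfl hz, dist_eq_norm, h₀, h₀, ← map_sub, ← mul_sub,
        mul_assoc]
      exact ω.le_opNorm_of_le (norm_mul_le_of_le le_rfl (hnorm _ m n))
    · rw [show z = (z.re : ℂ) + b * I by rw [← hz, re_add_im], dist_eq_norm, h₁, h₁, ← map_sub,
        ← sub_mul, mul_assoc, mul_comm ‖x‖]
      exact ω.le_opNorm_of_le (norm_mul_le_of_le (hnorm _ m n) le_rfl)
  rw [Metric.uniformCauchySeqOn_iff]
  intro ε hε
  obtain ⟨N, hN⟩ := Metric.cauchySeq_iff.1 hu (ε / (‖ω‖ * ‖x‖ + 1)) (by positivity)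
  refine ⟨N, fun m hm n hn z hz => (hbound m n z hz).trans_lt ?_⟩
  calc ‖ω‖ * ‖x‖ * dist (u m) (u n) ≤ (‖ω‖ * ‖x‖ + 1) * dist (u m) (u n) := by
        gcongr; linarith
    _ < ε := (lt_div_iff₀' (by positivity)).1 (hN m hm n hn)

theorem isKMSState_of_dense (hω : IsState ω) (hb : 0 < b)
    (h : Dense (kmsSubalgebra α b ω : Set B)) : IsKMSState α b ω := by
  refine ⟨hω, fun x y => ?_⟩
  obtain ⟨u, hu, hlim⟩ := mem_closure_iff_seq_limit.1 (h y)
  choose G hG hG' using hu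
  have hreal : ∀ n (t : ℝ), ω (x * G n t) = ω (x * α t (u n)) := fun n t => by
    rw [(hG n).apply_ofReal]
  obtain ⟨F, hF, hunif⟩ := IsStripFunction.exists_tendstoUniformlyOn
    (fun n => (hG n).isStripFunction ω x) hb
    (uniformCauchySeqOn_boundary hlim.cauchySeq hreal fun n t => hG' n x t)
  have hα : ∀ t, Tendsto (fun n => α t (u n)) atTop (𝓝 (α t y)) := fun t =>
    ((StarAlgEquiv.isometry (α t)).continuous.tendsto y).comp hlim
  have h₀ : ∀ t : ℝ, (t : ℂ) ∈ im ⁻¹' Icc 0 b := fun t => by simp [hb.le]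
  have h₁ : ∀ t : ℝ, (t + b * I : ℂ) ∈ im ⁻¹' Icc 0 b := fun t => by simp [hb.le]
  refine ⟨F, hF.continuousOn, hF.differentiableOn, hF.bounded, fun t => ⟨?_, ?_⟩⟩
  · refine tendsto_nhds_unique (hunif.tendsto_at (h₀ t)) ?_
    simp only [hreal]
    exact (ω.continuous.tendsto _).comp ((hα t).const_mul x)
  · refine tendsto_nhds_unique (hunif.tendsto_at (h₁ t)) ?_
    simp only [hG']
    exact (ω.continuous.tendsto _).comp ((hα t).mul_const x)

end KMS

open scoped ComplexOrder CStarAlgebra in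
theorem IsState.apply_star {B : Type*} [CStarAlgebra B] {ω : B →L[ℂ] ℂ} (hω : IsState ω)
    (x : B) : ω (star x) = star (ω x) := by
  let _ := CStarAlgebra.spectralOrder B
  have := CStarAlgebra.spectralOrderedRing B
  let ψ : B →ₚ[ℂ] ℂ := .mk₀ ω.toLinearMap fun x hx => by
    obtain ⟨y, rfl⟩ := CStarAlgebra.nonneg_iff_eq_star_mul_self.1 hx
    exact hω.nonneg y
  exact map_star ψ x

/-! ### States of `C(X)` and probability measures -/

section Riesz

variable {X : Type*} [TopologicalSpace X]

theorem ext_realToRCLike {φ ψ : C(X, ℂ) →L[ℂ] ℂ}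
    (h : ∀ f : C(X, ℝ), φ (f.realToRCLike ℂ) = ψ (f.realToRCLike ℂ)) : φ = ψ := by
  have hsa : ∀ f : selfAdjoint C(X, ℂ), φ f = ψ f := fun f => by
    rw [← ContinuousMap.IsSelfAdjoint.realToRCLike_rclikeToReal f.2, h]
  ext f
  rw [← realPart_add_I_smul_imaginaryPart f, map_add, map_add, map_smul, map_smul, hsa, hsa]

variable [CompactSpace X]

theorem IsState.realToRCLike_nonneg {ψ : C(X, ℂ) →L[ℂ] ℂ} (hψ : IsState ψ) {f : C(X, ℝ)}
    (hf : 0 ≤ f) : 0 ≤ (ψ (f.realToRCLike ℂ)).re := by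
  let g : C(X, ℝ) := ⟨fun x => √(f x), by fun_prop⟩
  have hfg : f = g * g := ContinuousMap.ext fun x => (Real.mul_self_sqrt (hf x)).symm
  have hstar : star (g.realToRCLike ℂ) = g.realToRCLike ℂ :=
    ContinuousMap.isSelfAdjoint_realToRCLike ℂ
  rw [hfg, ContinuousMap.realToRCLike_mul]
  nth_rewrite 1 [← hstar]
  exact (Complex.le_def.1 (hψ.nonneg _)).1

theorem IsState.im_realToRCLike {ψ : C(X, ℂ) →L[ℂ] ℂ} (hψ : IsState ψ) (f : C(X, ℝ)) :
    (ψ (f.realToRCLike ℂ)).im = 0 := by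
  have h := hψ.apply_star (f.realToRCLike ℂ)
  rw [show star (f.realToRCLike ℂ) = f.realToRCLike ℂ from
    ContinuousMap.isSelfAdjoint_realToRCLike ℂ] at h
  exact conj_eq_iff_im.1 h.symm

open CompactlySupported in
/-- The restriction of a state of `C(X)` to the real-valued functions, in the form to which the
Riesz–Markov–Kakutani theorem applies. -/
def IsState.realFunctional {ψ : C(X, ℂ) →L[ℂ] ℂ} (hψ : IsState ψ) : C_c(X, ℝ) →ₚ[ℝ] ℝ :=
  .mk₀
    { toFun f := (ψ (f.toContinuousMap.realToRCLike ℂ)).re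
      map_add' f g := by
        have h : (f + g).toContinuousMap.realToRCLike ℂ =
            f.toContinuousMap.realToRCLike ℂ + g.toContinuousMap.realToRCLike ℂ := by ext; simp
        rw [h, map_add, add_re]
      map_smul' c f := by
        have h : (c • f).toContinuousMap.realToRCLike ℂ =
            (c : ℂ) • f.toContinuousMap.realToRCLike ℂ := by ext; simp
        rw [h, map_smul, smul_eq_mul, re_ofReal_mul]
        rfl }
    fun _ hf => hψ.realToRCLike_nonneg hf

variable [MeasurableSpace X] [BorelSpace X]

theorem integrable_continuousMap (μ : Measure X) [IsFiniteMeasure μ] (f : C(X, ℂ)) :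
    Integrable f μ :=
  f.continuous.integrable_of_hasCompactSupport (HasCompactSupport.of_compactSpace f)

/-- Integration against a finite measure, as a functional on `C(X)`. -/
def integralCLM (μ : Measure X) [IsFiniteMeasure μ] : C(X, ℂ) →L[ℂ] ℂ :=
  LinearMap.mkContinuous
    { toFun f := ∫ x, f x ∂μ
      map_add' f g := integral_add (integrable_continuousMap μ f) (integrable_continuousMap μ g)
      map_smul' c f := integral_const_mul c f }
    (μ.real univ) fun f => by
      rw [mul_comm]
      exact norm_integral_le_of_norm_le_const (.of_forall f.norm_coe_le_norm)

theorem integralCLM_apply (μ : Measure X) [IsFiniteMeasure μ] (f : C(X, ℂ)) :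
    integralCLM μ f = ∫ x, f x ∂μ := rfl

theorem integralCLM_realToRCLike (μ : Measure X) [IsFiniteMeasure μ] (f : C(X, ℝ)) :
    integralCLM μ (f.realToRCLike ℂ) = (∫ x, f x ∂μ : ℝ) := integral_ofReal

theorem integralCLM_injective [HasOuterApproxClosed X] :
    Function.Injective fun μ : ProbabilityMeasure X => integralCLM (μ : Measure X) := by
  intro μ ν h
  have hμν : (μ : Measure X) = ν := ext_of_forall_integral_eq_of_IsFiniteMeasure fun f => by
    have hf := DFunLike.congr_fun h (f.toContinuousMap.realToRCLike ℂ)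
    simp only [integralCLM_realToRCLike, ofReal_inj] at hf
    exact hf
  exact Subtype.ext hμν

theorem IsState.exists_measure [T2Space X] {ψ : C(X, ℂ) →L[ℂ] ℂ} (hψ : IsState ψ) :
    ∃ μ : ProbabilityMeasure X, ψ = integralCLM (μ : Measure X) := by
  let μ : Measure X := RealRMK.rieszMeasure hψ.realFunctional
  have hμ : ψ = integralCLM μ := ext_realToRCLike fun f => by
    have hre : ∫ x, f x ∂μ = (ψ (f.realToRCLike ℂ)).re :=
      RealRMK.integral_rieszMeasure hψ.realFunctional
        (CompactlySupportedContinuousMap.continuousMapEquiv f)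
    rw [integralCLM_realToRCLike, hre]
    exact Complex.ext rfl (hψ.im_realToRCLike f)
  have hprob : μ.real univ = 1 := by
    have h := hψ.map_one
    rw [hμ, integralCLM_apply] at h
    simpa using h
  exact ⟨⟨μ, ⟨(ENNReal.toReal_eq_one_iff _).1 hprob⟩⟩, hμ⟩

end Riesz

variable {d : ℕ} {A : Matrix (Fin d) (Fin d) ℕ}

/-! ### Words in the generators -/

namespace CKAlgebra

theorem of_letter_true (i : Fin d) :
    of A (FreeStarAlgebra.letter (i, true)) = star (s A i) :=
  (congrArg (of A) (FreeStarAlgebra.star_letter (i, false)).symm).trans (star_of A _).symm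

theorem dense_adjoin_generators :
    Dense (Algebra.adjoin ℂ (range (s A) ∪ star (range (s A))) : Set (CKAlgebra A)) := by
  refine (denseRange_of A).mono (range_subset_iff.2 fun y => ?_)
  induction y using FreeStarAlgebra.induction with
  | hc c => exact (of A).commutes c ▸ Subalgebra.algebraMap_mem _ c
  | hl p =>
    obtain ⟨i, _ | _⟩ := p
    · exact Algebra.subset_adjoin (.inl ⟨i, rfl⟩)
    · rw [of_letter_true]
      exact Algebra.subset_adjoin (.inr (star_mem_star.2 ⟨i, rfl⟩))
  | hadd x y hx hy =>
    exact (map_add (of A) x y : of A (x + y) = _) ▸ add_mem hx hy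
  | hmul x y hx hy =>
    exact (map_mul (of A) x y : of A (x * y) = _) ▸ mul_mem hx hy

theorem word_nil : word A [] = 1 := by simp [word]

theorem word_cons (i : Fin d) (w : List (Fin d)) : word A (i :: w) = s A i * word A w := by
  simp [word]

theorem word_append (v w : List (Fin d)) : word A (v ++ w) = word A v * word A w := by
  simp [word]

theorem star_word_append_singleton (w : List (Fin d)) (i : Fin d) :
    star (word A (w ++ [i])) = star (s A i) * star (word A w) := by
  rw [word_append, word_cons, word_nil, mul_one, star_mul]

theorem source_mul_s (i j : Fin d) : star (s A i) * s A i * s A j = A i j • s A j := by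
  rw [source_eq, Finset.sum_mul, Finset.sum_eq_single j]
  · rw [smul_mul_assoc, wordProj_singleton, (isCKFamily_s A).partial_isometry]
  · intro k _ hk
    rw [smul_mul_assoc, wordProj_singleton, mul_assoc, star_s_mul_s_of_ne A hk, mul_zero,
      smul_zero]
  · simp

variable (A) in
/-- The span of the elements `s v (s w)*`, a dense subspace of `O_A`. -/
def wordSpan : Submodule ℂ (CKAlgebra A) :=
  Submodule.span ℂ (range fun p : List (Fin d) × List (Fin d) => word A p.1 * star (word A p.2))

theorem word_mul_star_word_mem (v w : List (Fin d)) :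
    word A v * star (word A w) ∈ wordSpan A := Submodule.subset_span ⟨(v, w), rfl⟩

theorem mul_mem_wordSpan {b : CKAlgebra A}
    (hb : ∀ v w, b * (word A v * star (word A w)) ∈ wordSpan A) {x : CKAlgebra A}
    (hx : x ∈ wordSpan A) : b * x ∈ wordSpan A := by
  have hle : wordSpan A ≤ (wordSpan A).comap (LinearMap.mulLeft ℂ b) :=
    Submodule.span_le.2 (range_subset_iff.2 fun p => hb p.1 p.2)
  exact hle hx

theorem s_mul_word_mem (i : Fin d) (v w : List (Fin d)) :
    s A i * (word A v * star (word A w)) ∈ wordSpan A := by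
  rw [← mul_assoc, ← word_cons]
  exact word_mul_star_word_mem _ _

theorem source_mul_word_mem (i : Fin d) (v w : List (Fin d)) :
    star (s A i) * s A i * (word A v * star (word A w)) ∈ wordSpan A := by
  rcases v with _ | ⟨j, v⟩
  · rw [source_eq, Finset.sum_mul]
    refine sum_mem fun j _ => ?_
    rw [smul_mul_assoc, wordProj_singleton, word_nil, one_mul, mul_assoc,
      ← star_word_append_singleton, ← mul_one (s A j), ← word_nil, ← word_cons]
    exact nsmul_mem (word_mul_star_word_mem _ _) _
  · rw [word_cons, mul_assoc (s A j), ← mul_assoc, source_mul_s, smul_mul_assoc]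
    exact nsmul_mem (s_mul_word_mem j v w) _

theorem star_s_mul_word_mem (i : Fin d) (v w : List (Fin d)) :
    star (s A i) * (word A v * star (word A w)) ∈ wordSpan A := by
  rcases v with _ | ⟨j, v⟩
  · rw [word_nil, one_mul, ← star_word_append_singleton, ← one_mul (star _), ← word_nil]
    exact word_mul_star_word_mem _ _
  · rw [word_cons, mul_assoc (s A j), ← mul_assoc]
    obtain rfl | hij := eq_or_ne i j
    · exact source_mul_word_mem i v w
    · rw [star_s_mul_s_of_ne A hij, zero_mul]
      exact zero_mem _

theorem dense_wordSpan : Dense (wordSpan A : Set (CKAlgebra A)) := by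
  have hmul : ∀ b ∈ Algebra.adjoin ℂ (range (s A) ∪ star (range (s A))),
      ∀ x ∈ wordSpan A, b * x ∈ wordSpan A := fun b hb => by
    induction hb using Algebra.adjoin_induction with
    | mem b hb =>
      obtain ⟨i, rfl⟩ | ⟨i, hi⟩ := hb
      · exact fun x => mul_mem_wordSpan (s_mul_word_mem i)
      · rw [← star_star b, ← hi]
        exact fun x => mul_mem_wordSpan (star_s_mul_word_mem i)
    | algebraMap c => exact fun x hx => by rw [← Algebra.smul_def]; exact Submodule.smul_mem _ c hx
    | add a b _ _ ha hb => exact fun x hx => by rw [add_mul]; exact add_mem (ha x hx) (hb x hx)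
    | mul a b _ _ ha hb => exact fun x hx => by rw [mul_assoc]; exact ha _ (hb x hx)
  have hone : (1 : CKAlgebra A) ∈ wordSpan A := by
    simpa [word_nil] using word_mul_star_word_mem (A := A) [] []
  exact dense_adjoin_generators.mono fun b hb => by simpa using hmul b hb 1 hone

theorem ext_word {φ ψ : CKAlgebra A →L[ℂ] ℂ}
    (h : ∀ v w, φ (word A v * star (word A w)) = ψ (word A v * star (word A w))) : φ = ψ :=
  ContinuousLinearMap.ext_on dense_wordSpan (by rintro _ ⟨p, rfl⟩; exact h p.1 p.2)

theorem norm_word_le (w : List (Fin d)) : ‖word A w‖ ≤ 1 := by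
  induction w with
  | nil => rw [word_nil, ← map_one (of A), norm_of]; exact (isCKSeminorm_ckSeminorm A).one_le
  | cons i w ih =>
    have hs : ‖s A i‖ ≤ 1 := (norm_of A _).trans_le ((isCKSeminorm_ckSeminorm A).gen_le i)
    rw [word_cons]
    exact (norm_mul_le _ _).trans (mul_le_one₀ hs (norm_nonneg _) ih)

end CKAlgebra

/-! ### Continuous functions on the subshift -/

instance : CompactSpace (Subshift A) := by
  refine isCompact_iff_compactSpace.1 (IsClosed.isCompact ?_)
  have hclosed : ∀ n, IsClosed {x : ℕ → Fin d | A (x n) (x (n + 1)) = 1} := fun n =>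
    (isClosed_discrete {q : Fin d × Fin d | A q.1 q.2 = 1}).preimage
      (f := fun x : ℕ → Fin d => (x n, x (n + 1))) (by fun_prop)
  change IsClosed {x : ℕ → Fin d | ∀ n, A (x n) (x (n + 1)) = 1}
  simpa only [ofPred_forall] using isClosed_iInter hclosed

instance : TopologicalSpace.PseudoMetrizableSpace (Subshift A) :=
  IsInducing.subtypeVal.pseudoMetrizableSpace

theorem initWord_injective : Function.Injective fun x : ℕ → Fin d => initWord x := by
  intro x y h
  funext n
  have hn := congrFun h (n + 1)
  simpa [initWord_succ, congrFun h n] using hn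

theorem initWord_prepend (i : Fin d) (x : Subshift A) (h : A i (x.1 0) = 1) (n : ℕ) :
    initWord (prepend i x h).1 (n + 1) = i :: initWord x.1 n := by
  simp only [initWord, List.range_succ_eq_map, List.map_cons, List.map_map]
  rfl

namespace CKAlgebra

theorem cylinderIndicator_apply (w : List (Fin d)) (x : Subshift A) :
    cylinderIndicator A w x = if initWord x.1 w.length = w then 1 else 0 := rfl

theorem cylinderIndicator_nil : cylinderIndicator A [] = 1 := by
  ext x
  simp [cylinderIndicator_apply, initWord]

theorem star_cylinderIndicator (w : List (Fin d)) :
    star (cylinderIndicator A w) = cylinderIndicator A w := by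
  ext x
  simp [cylinderIndicator_apply, apply_ite]

theorem separatesPoints_adjoin_cylinderIndicator :
    (StarAlgebra.adjoin ℂ (range (cylinderIndicator A))).SeparatesPoints := by
  intro x y hxy
  by_contra! h
  refine hxy (Subtype.ext (initWord_injective (funext fun n => ?_)))
  have hn := h _ ⟨_, StarAlgebra.subset_adjoin ℂ _ ⟨initWord x.1 n, rfl⟩, rfl⟩
  by_contra hne
  simp [cylinderIndicator_apply, length_initWord, Ne.symm hne] at hn

theorem dense_adjoin_cylinderIndicator :
    Dense (Algebra.adjoin ℂ (range (cylinderIndicator A)) : Set C(Subshift A, ℂ)) := by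
  have hstar : star (range (cylinderIndicator A)) = range (cylinderIndicator A) := by
    rw [← Set.image_star, ← range_comp]
    exact congrArg range (funext star_cylinderIndicator)
  have hadj : (StarAlgebra.adjoin ℂ (range (cylinderIndicator A))).toSubalgebra =
      Algebra.adjoin ℂ (range (cylinderIndicator A)) := by
    rw [StarAlgebra.adjoin_toSubalgebra, hstar, union_self]
  rw [← hadj]
  exact fun f => show f ∈ (StarAlgebra.adjoin ℂ _).topologicalClosure from
    ContinuousMap.starSubalgebra_topologicalClosure_eq_top_of_separatesPoints _
      separatesPoints_adjoin_cylinderIndicator ▸ StarSubalgebra.mem_top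

theorem cylinderIndicator_induction {p : C(Subshift A, ℂ) → Prop} (closed : IsClosed {f | p f})
    (algebraMap : ∀ c : ℂ, p (algebraMap ℂ _ c))
    (cylinderIndicator : ∀ w, p (cylinderIndicator A w))
    (add : ∀ f g, p f → p g → p (f + g)) (mul : ∀ f g, p f → p g → p (f * g))
    (f : C(Subshift A, ℂ)) : p f := by
  refine closure_minimal (t := {f | p f}) (fun g hg => ?_) closed
    (dense_adjoin_cylinderIndicator f)
  induction hg using Algebra.adjoin_induction with
  | mem g hg => obtain ⟨w, rfl⟩ := hg; exact cylinderIndicator w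
  | algebraMap c => exact algebraMap c
  | add f g _ _ hf hg => exact add f g hf hg
  | mul f g _ _ hf hg => exact mul f g hf hg

end CKAlgebra

/-! ### Inverse branches of the shift -/

/-- The inverse branch `f ↦ f (i ·)` of the shift, extended by zero to the points that `i` cannot
precede; in `O_A` it is implemented by `f ↦ (s i)* f (s i)`. -/
def branch (i : Fin d) : C(Subshift A, ℂ) →⋆ₙₐ[ℂ] C(Subshift A, ℂ) where
  toFun f := ⟨fun x => if h : A i (x.1 0) = 1 then f (prepend i x h) else 0, continuous_branch i f⟩
  map_smul' c f := by
    ext x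
    simp only [ContinuousMap.coe_mk, ContinuousMap.smul_apply]
    split_ifs <;> simp
  map_zero' := by ext; simp
  map_add' f g := by
    ext x
    simp only [ContinuousMap.coe_mk, ContinuousMap.add_apply]
    split_ifs <;> simp
  map_mul' f g := by
    ext x
    simp only [ContinuousMap.coe_mk, ContinuousMap.mul_apply]
    split_ifs <;> simp
  map_star' f := by
    ext x
    simp only [ContinuousMap.coe_mk, ContinuousMap.star_apply]
    split_ifs <;> simp

theorem branch_apply (i : Fin d) (f : C(Subshift A, ℂ)) (x : Subshift A) :
    branch i f x = if h : A i (x.1 0) = 1 then f (prepend i x h) else 0 := rfl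

namespace CKAlgebra

theorem branch_cylinderIndicator_cons (i j : Fin d) (w : List (Fin d)) :
    branch i (cylinderIndicator A (j :: w)) =
      if i = j then branch i 1 * cylinderIndicator A w else 0 := by
  ext x
  rw [branch_apply]
  by_cases hij : i = j
  · subst hij
    simp only [cylinderIndicator_apply, List.length_cons, initWord_prepend, if_true,
      ContinuousMap.mul_apply, branch_apply, List.cons.injEq, true_and]
    split_ifs <;> simp
  · simp [cylinderIndicator_apply, initWord_prepend, hij]

theorem branch_one (hA01 : ∀ i j, A i j = 0 ∨ A i j = 1) (i : Fin d) :
    branch i (1 : C(Subshift A, ℂ)) = ∑ j, A i j • cylinderIndicator A [j] := by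
  ext x
  have hletter : ∀ j, cylinderIndicator A [j] x = if x.1 0 = j then 1 else 0 := fun j => by
    simp [cylinderIndicator_apply, initWord]
  obtain h | h := hA01 i (x.1 0) <;>
    simp [branch_apply, ContinuousMap.sum_apply, hletter, h]

variable (A) in
/-- `diagEmbedding` as a continuous linear map. -/
def diagCLM : C(Subshift A, ℂ) →L[ℂ] CKAlgebra A where
  toLinearMap := (diagEmbedding A).toAlgHom.toLinearMap
  cont := by
    open scoped CStarAlgebra in exact map_continuous (diagEmbedding A)

theorem continuous_diagEmbedding : Continuous (diagEmbedding A) := (diagCLM A).continuous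

theorem diagEmbedding_branch_one (hA01 : ∀ i j, A i j = 0 ∨ A i j = 1) (i : Fin d) :
    diagEmbedding A (branch i 1) = star (s A i) * s A i := by
  simp_rw [branch_one hA01, map_sum, map_nsmul, diagEmbedding_cylinderIndicator, source_eq]

theorem s_mul_diagEmbedding_branch_one (hA01 : ∀ i j, A i j = 0 ∨ A i j = 1) (i : Fin d) :
    s A i * diagEmbedding A (branch i 1) = s A i := by
  rw [diagEmbedding_branch_one hA01, ← mul_assoc, (isCKFamily_s A).partial_isometry]

theorem diagEmbedding_cylinderIndicator_mul_s (hA01 : ∀ i j, A i j = 0 ∨ A i j = 1) (i : Fin d)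
    (w : List (Fin d)) :
    diagEmbedding A (cylinderIndicator A w) * s A i =
      s A i * diagEmbedding A (branch i (cylinderIndicator A w)) := by
  rcases w with _ | ⟨j, w⟩
  · rw [cylinderIndicator_nil, s_mul_diagEmbedding_branch_one hA01, map_one, one_mul]
  rw [branch_cylinderIndicator_cons, diagEmbedding_cylinderIndicator, wordProj_cons]
  split_ifs with hij
  · subst hij
    rw [map_mul, diagEmbedding_cylinderIndicator, ← mul_assoc,
      s_mul_diagEmbedding_branch_one hA01, mul_assoc, mul_assoc, ← (commute_source A i w).eq,
      ← mul_assoc, ← mul_assoc, (isCKFamily_s A).partial_isometry]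
  · rw [mul_assoc, star_s_mul_s_of_ne A (Ne.symm hij), map_zero, mul_zero, mul_zero]

theorem diagEmbedding_mul_s (hA01 : ∀ i j, A i j = 0 ∨ A i j = 1) (i : Fin d)
    (f : C(Subshift A, ℂ)) :
    diagEmbedding A f * s A i = s A i * diagEmbedding A (branch i f) := by
  induction f using cylinderIndicator_induction with
  | closed =>
    open scoped CStarAlgebra in
    exact isClosed_eq (continuous_diagEmbedding.mul_const _)
      ((continuous_diagEmbedding.comp (map_continuous (branch i))).const_mul _)
  | algebraMap c =>
    rw [Algebra.algebraMap_eq_smul_one, map_smul, map_smul, map_smul, map_one, mul_smul_comm,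
      s_mul_diagEmbedding_branch_one hA01, smul_mul_assoc, one_mul]
  | cylinderIndicator w => exact diagEmbedding_cylinderIndicator_mul_s hA01 i w
  | add f g hf hg => rw [map_add, map_add, map_add, add_mul, mul_add, hf, hg]
  | mul f g hf hg => rw [map_mul, map_mul, map_mul, mul_assoc, hg, ← mul_assoc, hf, mul_assoc]

theorem star_s_mul_diagEmbedding_mul_s (hA01 : ∀ i j, A i j = 0 ∨ A i j = 1) (i j : Fin d)
    (f : C(Subshift A, ℂ)) :
    star (s A j) * diagEmbedding A f * s A i =
      if j = i then diagEmbedding A (branch i f) else 0 := by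
  rw [mul_assoc, diagEmbedding_mul_s hA01, ← mul_assoc]
  split_ifs with hij
  · rw [hij, ← diagEmbedding_branch_one hA01, ← map_mul, ← map_mul, one_mul]
  · rw [star_s_mul_s_of_ne A hij, zero_mul]

/-! ### The flow and conformality -/

variable (a : selfAdjoint C(Subshift A, ℂ)) (β : ℝ)

/-- The entire extension `exp (i z (β - a))` of `phase`. -/
def phaseExt (z : ℂ) : C(Subshift A, ℂ) where
  toFun x := exp (I * z * (β - a.1 x))
  continuous_toFun := by fun_prop

theorem phaseExt_apply (z : ℂ) (x : Subshift A) :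
    phaseExt a β z x = exp (I * z * (β - a.1 x)) := rfl

theorem phaseExt_ofReal (t : ℝ) : phaseExt a β t = phase a β t := rfl

theorem phaseExt_add (z w : ℂ) : phaseExt a β (z + w) = phaseExt a β z * phaseExt a β w := by
  ext x
  rw [ContinuousMap.mul_apply, phaseExt_apply, phaseExt_apply, phaseExt_apply, ← Complex.exp_add]
  ring_nf

theorem conj_selfAdjoint_apply (x : Subshift A) : conj (a.1 x) = a.1 x :=
  DFunLike.congr_fun (selfAdjoint.star_val_eq (x := a)) x

theorem star_phaseExt (z : ℂ) : star (phaseExt a β z) = phaseExt a β (-conj z) := by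
  ext x
  rw [ContinuousMap.star_apply, phaseExt_apply, phaseExt_apply, star_def, ← exp_conj]
  simp only [map_mul, map_sub, conj_I, conj_ofReal, conj_selfAdjoint_apply]
  ring_nf

theorem phaseExt_I_apply (x : Subshift A) : phaseExt a β I x = exp (a.1 x - β) := by
  rw [phaseExt_apply, I_mul_I]
  ring_nf

theorem ruelle_eq_sum_branch (f : C(Subshift A, ℂ)) :
    ruelle a.1 f = (Real.exp β : ℂ) • ∑ i, branch i (phaseExt a β I * f) := by
  have hexp : ∀ x, exp (a.1 x) = Real.exp β * phaseExt a β I x := fun x => by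
    rw [phaseExt_I_apply, ofReal_exp, ← Complex.exp_add, add_sub_cancel]
  ext x
  change (∑ i, if h : A i (x.1 0) = 1 then exp (a.1 (prepend i x h)) * f (prepend i x h) else 0) = _
  rw [ContinuousMap.smul_apply, ContinuousMap.sum_apply, smul_eq_mul, Finset.mul_sum]
  refine Finset.sum_congr rfl fun i _ => ?_
  rw [branch_apply, mul_dite, mul_zero]
  simp only [hexp, ContinuousMap.mul_apply, mul_assoc]

theorem differentiable_phaseExt : Differentiable ℂ (phaseExt a β) := by
  let h : C(Subshift A, ℂ) := ⟨fun x => I * (β - a.1 x), by fun_prop⟩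
  have hexp : phaseExt a β = fun z : ℂ => NormedSpace.exp (z • h) := by
    funext z
    ext x
    have hx := NormedSpace.map_exp (ContinuousMap.evalAlgHom ℂ ℂ x)
      (continuous_eval_const x) (z • h)
    refine Eq.trans ?_ hx.symm
    rw [← Complex.exp_eq_exp_ℂ, phaseExt_apply]
    exact congrArg exp (by rw [mul_comm I, mul_assoc]; rfl)
  exact hexp ▸ differentiable_exp_smul_const ℂ h

theorem norm_phaseExt_le (z : ℂ) :
    ‖phaseExt a β z‖ ≤ Real.exp (|z.im| * (|β| + ‖a.1‖)) := by
  refine (ContinuousMap.norm_le _ (Real.exp_nonneg _)).2 fun x => ?_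
  have hre : (I * z * (β - a.1 x)).re = -(z.im * (β - (a.1 x).re)) := by
    rw [← conj_eq_iff_re.1 (conj_selfAdjoint_apply a x), ← ofReal_sub, re_mul_ofReal, ofReal_re]
    simp
  rw [phaseExt_apply, norm_exp, hre]
  refine Real.exp_le_exp.2 ((neg_le_abs _).trans ?_)
  rw [abs_mul]
  gcongr
  exact (abs_sub _ _).trans (by gcongr; exact (abs_re_le_norm _).trans (a.1.norm_coe_le_norm x))

theorem norm_diagEmbedding_phaseExt_le {z : ℂ} (hz : |z.im| ≤ 1) :
    ‖diagEmbedding A (phaseExt a β z)‖ ≤ Real.exp (|β| + ‖a.1‖) :=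
  calc ‖diagEmbedding A (phaseExt a β z)‖ ≤ ‖phaseExt a β z‖ :=
        NonUnitalStarAlgHom.norm_apply_le (diagEmbedding A) _
    _ ≤ Real.exp (|z.im| * (|β| + ‖a.1‖)) := norm_phaseExt_le a β z
    _ ≤ Real.exp (|β| + ‖a.1‖) :=
        Real.exp_le_exp.2 (mul_le_of_le_one_left (by positivity) hz)

theorem differentiable_diagEmbedding_phaseExt :
    Differentiable ℂ fun z => diagEmbedding A (phaseExt a β z) :=
  (diagCLM A).differentiable.comp (differentiable_phaseExt a β)

theorem flow_diagEmbedding (t : ℝ) (f : C(Subshift A, ℂ)) :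
    flow a β t (diagEmbedding A f) = diagEmbedding A f :=
  flowHom_of_mem_diagonal a β t (diagEmbedding_mem A f)

theorem flow_star_s (t : ℝ) (i : Fin d) :
    flow a β t (star (s A i)) = star (s A i) * diagEmbedding A (phaseExt a β (-t)) := by
  rw [map_star, flow_s, star_mul, ← map_star, ← phaseExt_ofReal, star_phaseExt, conj_ofReal]

theorem isAnalyticExtension_s (i : Fin d) : IsAnalyticExtension (flow a β) 1 (s A i)
    fun z => diagEmbedding A (phaseExt a β z) * s A i where
  differentiable := (differentiable_diagEmbedding_phaseExt a β).mul (differentiable_const _)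
  bounded := ⟨_, fun z h0 h1 => norm_mul_le_of_le
    (norm_diagEmbedding_phaseExt_le a β (abs_le.2 ⟨by linarith, h1⟩)) le_rfl⟩
  apply_ofReal t := (flow_s a β t i).symm

theorem isAnalyticExtension_star_s (i : Fin d) :
    IsAnalyticExtension (flow a β) 1 (star (s A i))
      fun z => star (s A i) * diagEmbedding A (phaseExt a β (-z)) where
  differentiable := (differentiable_const _).mul
    ((differentiable_diagEmbedding_phaseExt a β).comp differentiable_neg)
  bounded := ⟨_, fun z h0 h1 => norm_mul_le_of_le le_rfl (norm_diagEmbedding_phaseExt_le a β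
    (by rw [neg_im, abs_neg]; exact abs_le.2 ⟨by linarith, h1⟩))⟩
  apply_ofReal t := (flow_star_s a β t i).symm

theorem isAnalyticExtension_diagEmbedding (f : C(Subshift A, ℂ)) :
    IsAnalyticExtension (flow a β) 1 (diagEmbedding A f) fun _ => diagEmbedding A f where
  differentiable := differentiable_const _
  bounded := ⟨_, fun _ _ _ => le_rfl⟩
  apply_ofReal t := (flow_diagEmbedding a β t f).symm

/-- The KMS condition for `flow a β`, evaluated at `t = 0` on the generators `s i` and on the
diagonal only. By `IsConformal.isKMSState` it already implies the full KMS condition. -/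
structure IsConformal (ω : CKAlgebra A →L[ℂ] ℂ) : Prop where
  apply_mul_s : ∀ (i : Fin d) (x : CKAlgebra A),
    ω (x * diagEmbedding A (phaseExt a β I) * s A i) = ω (s A i * x)
  apply_comm : ∀ (f : C(Subshift A, ℂ)) (x : CKAlgebra A),
    ω (x * diagEmbedding A f) = ω (diagEmbedding A f * x)

variable {a β} {ω : CKAlgebra A →L[ℂ] ℂ}

theorem isConformal_of_isKMSState (h : IsKMSState (flow a β) 1 ω) : IsConformal a β ω where
  apply_mul_s i x := by
    simpa [mul_assoc] using
      h.apply_mul_eq one_pos (flow_zero a β) (isAnalyticExtension_s a β i) x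
  apply_comm f x :=
    h.apply_mul_eq one_pos (flow_zero a β) (isAnalyticExtension_diagEmbedding a β f) x

namespace IsConformal

theorem apply_mul_star_s (h : IsConformal a β ω) (hω : IsState ω) (i : Fin d) (x : CKAlgebra A) :
    ω (star (s A i) * diagEmbedding A (phaseExt a β I) * x) = ω (x * star (s A i)) := by
  have hstar := congrArg star (h.apply_mul_s i (star x))
  rw [← hω.apply_star, ← hω.apply_star] at hstar
  simpa [← map_star, star_phaseExt, mul_assoc] using hstar

theorem s_mem_kmsSubalgebra (h : IsConformal a β ω) (i : Fin d) :
    s A i ∈ kmsSubalgebra (flow a β) 1 ω := by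
  refine ⟨_, isAnalyticExtension_s a β i, fun x t => ?_⟩
  rw [ofReal_one, one_mul, phaseExt_add, phaseExt_ofReal, map_mul (diagEmbedding A),
    ← mul_assoc, ← mul_assoc, h.apply_mul_s, ← mul_assoc, h.apply_comm, flow_s, mul_assoc]

theorem star_s_mem_kmsSubalgebra (h : IsConformal a β ω) (hω : IsState ω) (i : Fin d) :
    star (s A i) ∈ kmsSubalgebra (flow a β) 1 ω := by
  refine ⟨_, isAnalyticExtension_star_s a β i, fun x t => ?_⟩
  have hphase : phaseExt a β (-t) = phaseExt a β I * phaseExt a β (-(t + I)) := by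
    rw [← phaseExt_add]
    ring_nf
  rw [ofReal_one, one_mul, flow_star_s, hphase, map_mul (diagEmbedding A),
    ← mul_assoc (star _), mul_assoc _ _ x, h.apply_mul_star_s hω, ← mul_assoc, h.apply_comm,
    mul_assoc]

theorem isKMSState (h : IsConformal a β ω) (hω : IsState ω) : IsKMSState (flow a β) 1 ω := by
  refine isKMSState_of_dense hω one_pos (dense_adjoin_generators.mono (Algebra.adjoin_le ?_))
  rintro y (⟨i, rfl⟩ | ⟨i, hi⟩)
  · exact h.s_mem_kmsSubalgebra i
  · rw [← star_star y, ← hi]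
    exact h.star_s_mem_kmsSubalgebra hω i

theorem apply_ruelle (h : IsConformal a β ω) (hA01 : ∀ i j, A i j = 0 ∨ A i j = 1)
    (f : C(Subshift A, ℂ)) :
    ω (diagEmbedding A (ruelle a.1 f)) = Real.exp β * ω (diagEmbedding A f) := by
  have hbranch : ∀ i, ω (diagEmbedding A (branch i (phaseExt a β I * f))) =
      ω (s A i * star (s A i) * diagEmbedding A f) := fun i => by
    rw [mul_assoc, ← h.apply_mul_s, mul_assoc (star (s A i)), ← map_mul, mul_comm f,
      star_s_mul_diagEmbedding_mul_s hA01, if_pos rfl]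
  rw [ruelle_eq_sum_branch a β, map_smul, map_smul, map_sum, map_sum,
    Finset.sum_congr rfl fun i _ => hbranch i, ← map_sum, ← Finset.sum_mul,
    (isCKFamily_s A).sum_range, one_mul, smul_eq_mul]

end IsConformal

/-! ### Uniqueness of conformal states with a given restriction -/

namespace IsConformal

variable {ω' : CKAlgebra A →L[ℂ] ℂ}

theorem apply_word_cons_mul_diagEmbedding (h : IsConformal a β ω)
    (hA01 : ∀ i j, A i j = 0 ∨ A i j = 1) (i : Fin d) (w : List (Fin d)) (f : C(Subshift A, ℂ)) :
    ω (word A (i :: w) * diagEmbedding A f) =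
      ω (word A (w ++ [i]) * diagEmbedding A (branch i (f * phaseExt a β I))) := by
  rw [word_cons, mul_assoc, ← h.apply_mul_s, mul_assoc (word A w), ← map_mul, mul_assoc,
    diagEmbedding_mul_s hA01, ← mul_assoc, word_append, word_cons, word_nil, mul_one]

theorem apply_word_cons_mul_star_word_cons (h : IsConformal a β ω)
    (hA01 : ∀ i j, A i j = 0 ∨ A i j = 1) (i j : Fin d) (v w : List (Fin d))
    (f : C(Subshift A, ℂ)) :
    ω (word A (i :: v) * star (word A (j :: w)) * diagEmbedding A f) =
      if j = i then
        ω (word A v * star (word A w) * diagEmbedding A (branch i (f * phaseExt a β I)))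
      else 0 := by
  have hmid : star (word A (j :: w)) * diagEmbedding A f * diagEmbedding A (phaseExt a β I) *
      s A i = star (word A w) *
        if j = i then diagEmbedding A (branch i (f * phaseExt a β I)) else 0 := by
    rw [← star_s_mul_diagEmbedding_mul_s hA01, word_cons, star_mul, map_mul]
    simp only [mul_assoc]
  rw [word_cons, mul_assoc, mul_assoc, ← h.apply_mul_s, mul_assoc (word A v),
    mul_assoc (word A v), hmid]
  split_ifs
  · rw [← mul_assoc]
  · rw [mul_zero, mul_zero, map_zero]

theorem norm_apply_word_cons_le (h : IsConformal a β ω) (hA01 : ∀ i j, A i j = 0 ∨ A i j = 1)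
    (n : ℕ) (i : Fin d) (w : List (Fin d)) (f : C(Subshift A, ℂ)) :
    ‖ω (word A (i :: w) * diagEmbedding A f)‖ ≤ ‖ω‖ * (‖f‖ * ‖phaseExt a β I‖ ^ n) := by
  induction n generalizing i w f with
  | zero =>
    rw [pow_zero, mul_one, ← one_mul ‖f‖]
    exact ω.le_opNorm_of_le (norm_mul_le_of_le (norm_word_le _)
      (NonUnitalStarAlgHom.norm_apply_le (diagEmbedding A) f))
  | succ n ih =>
    have hbranch : ‖branch i (f * phaseExt a β I)‖ ≤ ‖f‖ * ‖phaseExt a β I‖ :=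
      (NonUnitalStarAlgHom.norm_apply_le (branch i) _).trans (norm_mul_le _ _)
    obtain ⟨j, v, hv⟩ : ∃ j v, w ++ [i] = j :: v := List.exists_cons_of_ne_nil (by simp)
    rw [h.apply_word_cons_mul_diagEmbedding hA01, hv, pow_succ', ← mul_assoc ‖f‖]
    exact (ih j v _).trans (by gcongr)

theorem apply_word_cons_eq_zero (h : IsConformal a β ω) (hA01 : ∀ i j, A i j = 0 ∨ A i j = 1)
    (hlt : ‖phaseExt a β I‖ < 1) (i : Fin d) (w : List (Fin d)) (f : C(Subshift A, ℂ)) :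
    ω (word A (i :: w) * diagEmbedding A f) = 0 := by
  have htendsto : Tendsto (fun n : ℕ => ‖ω‖ * (‖f‖ * ‖phaseExt a β I‖ ^ n)) atTop (𝓝 0) := by
    simpa using ((tendsto_pow_atTop_nhds_zero_of_lt_one (norm_nonneg _) hlt).const_mul
      ‖f‖).const_mul ‖ω‖
  exact norm_le_zero_iff.1 (ge_of_tendsto' htendsto fun n =>
    h.norm_apply_word_cons_le hA01 n i w f)

theorem apply_star_word_cons_eq_zero (h : IsConformal a β ω) (hω : IsState ω)
    (hA01 : ∀ i j, A i j = 0 ∨ A i j = 1) (hlt : ‖phaseExt a β I‖ < 1) (i : Fin d)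
    (w : List (Fin d)) (f : C(Subshift A, ℂ)) :
    ω (star (word A (i :: w)) * diagEmbedding A f) = 0 := by
  have hstar := hω.apply_star (word A (i :: w) * diagEmbedding A (star f))
  rwa [star_mul, ← map_star (diagEmbedding A), star_star, h.apply_word_cons_eq_zero hA01 hlt,
    star_zero, ← h.apply_comm] at hstar

theorem apply_word_mul_star_word_eq (h : IsConformal a β ω) (hω : IsState ω)
    (h' : IsConformal a β ω') (hω' : IsState ω') (hA01 : ∀ i j, A i j = 0 ∨ A i j = 1)
    (hlt : ‖phaseExt a β I‖ < 1) (heq : ∀ f, ω (diagEmbedding A f) = ω' (diagEmbedding A f))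
    (v w : List (Fin d)) (f : C(Subshift A, ℂ)) :
    ω (word A v * star (word A w) * diagEmbedding A f) =
      ω' (word A v * star (word A w) * diagEmbedding A f) := by
  induction v generalizing w f with
  | nil =>
    rcases w with _ | ⟨j, w⟩
    · simpa [word_nil] using heq f
    · rw [word_nil, one_mul, h.apply_star_word_cons_eq_zero hω hA01 hlt,
        h'.apply_star_word_cons_eq_zero hω' hA01 hlt]
  | cons i v ih =>
    rcases w with _ | ⟨j, w⟩
    · rw [word_nil, star_one, mul_one, h.apply_word_cons_eq_zero hA01 hlt,
        h'.apply_word_cons_eq_zero hA01 hlt]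
    · rw [h.apply_word_cons_mul_star_word_cons hA01, h'.apply_word_cons_mul_star_word_cons hA01, ih]

theorem eq_of_diagEmbedding (h : IsConformal a β ω) (hω : IsState ω)
    (h' : IsConformal a β ω') (hω' : IsState ω') (hA01 : ∀ i j, A i j = 0 ∨ A i j = 1)
    (hlt : ‖phaseExt a β I‖ < 1) (heq : ∀ f, ω (diagEmbedding A f) = ω' (diagEmbedding A f)) :
    ω = ω' :=
  ext_word fun v w => by
    simpa using h.apply_word_mul_star_word_eq hω h' hω' hA01 hlt heq v w 1

end IsConformal

end CKAlgebra

/-! ### Operators of partial bijections on `ℓ²` -/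

section Pullback

variable {X : Type*}

/-- The Hilbert space `ℓ²(X)`, on which the orbit representation of `O_A` acts. -/
abbrev EllTwo (X : Type*) : Type _ := lp (fun _ : X => ℂ) 2

open scoped Classical in
/-- The vector of the standard orthonormal basis of `ℓ²(X)` at `x`. -/
def basisVec (x : X) : EllTwo X := lp.single 2 x 1

open scoped Classical in
theorem basisVec_apply (x y : X) : basisVec x y = if y = x then 1 else 0 := by
  rw [basisVec, lp.single_apply, Pi.single_apply]

theorem norm_basisVec (x : X) : ‖basisVec x‖ = 1 := by
  classical
  rw [basisVec, lp.norm_single (by norm_num), norm_one]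

theorem inner_basisVec (x : X) (f : EllTwo X) : inner ℂ (basisVec x) f = f x := by
  classical
  simp [basisVec, lp.inner_single_left]

theorem sum_pullback_le (e : X ≃. X) (f : EllTwo X) (t : Finset X) :
    ∑ x ∈ t, ‖(e x).elim 0 f‖ ^ (2 : ENNReal).toReal ≤ ‖f‖ ^ (2 : ENNReal).toReal := by
  classical
  have hdisj : (t : Set X).PairwiseDisjoint fun x => (e x).toFinset := fun x _ y _ hxy =>
    Finset.disjoint_left.2 fun z hx hy =>
      hxy (e.inj (Option.mem_toFinset.1 hx) (Option.mem_toFinset.1 hy))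
  have hsum : ∀ x, ‖(e x).elim 0 f‖ ^ (2 : ENNReal).toReal =
      ∑ y ∈ (e x).toFinset, ‖f y‖ ^ (2 : ENNReal).toReal := fun x => by
    rcases e x with _ | y <;> simp
  rw [Finset.sum_congr rfl fun x _ => hsum x, ← Finset.sum_biUnion hdisj]
  exact lp.sum_rpow_le_norm_rpow (by norm_num) f _

/-- The operator `f ↦ f ∘ e` on `ℓ²(X)`, where `f ∘ e` is extended by zero; every partial isometry
of the orbit representation is of this form. -/
def pullback (e : X ≃. X) : EllTwo X →L[ℂ] EllTwo X :=
  LinearMap.mkContinuous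
    { toFun f := ⟨fun x => (e x).elim 0 f, memℓp_gen' (sum_pullback_le e f)⟩
      map_add' f g := by
        ext x
        change (e x).elim 0 (⇑f + ⇑g) = (e x).elim 0 f + (e x).elim 0 g
        rcases e x with _ | y <;> simp
      map_smul' c f := by
        ext x
        change (e x).elim 0 (c • ⇑f) = c * (e x).elim 0 f
        rcases e x with _ | y <;> simp }
    1 fun f => by
      rw [one_mul]
      exact lp.norm_le_of_forall_sum_le (by norm_num) (norm_nonneg f) (sum_pullback_le e f)

theorem pullback_apply (e : X ≃. X) (f : EllTwo X) (x : X) :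
    pullback e f x = (e x).elim 0 f := rfl

theorem pullback_mul (e e' : X ≃. X) : pullback e * pullback e' = pullback (e.trans e') := by
  ext f x
  change (e x).elim 0 (pullback e' f) = ((e x).bind e').elim 0 f
  rcases e x with _ | y <;> rfl

theorem pullback_basisVec (e : X ≃. X) (y : X) :
    pullback e (basisVec y) = (e.symm y).elim 0 basisVec := by
  ext x
  have hmem := (e.mem_iff_mem (a := x) (b := y)).symm
  rw [pullback_apply]
  rcases hx : e x with _ | z <;> rcases hy : e.symm y with _ | w <;>
    simp only [hx, hy, Option.mem_def, reduceCtorEq, Option.some.injEq] at hmem <;>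
    simp only [Option.elim_none, Option.elim_some, lp.coeFn_zero, Pi.zero_apply, basisVec_apply] <;>
    grind

theorem star_pullback (e : X ≃. X) : star (pullback e) = pullback e.symm := by
  ext f y
  rw [← inner_basisVec, ContinuousLinearMap.star_eq_adjoint,
    ContinuousLinearMap.adjoint_inner_right, pullback_basisVec, pullback_apply]
  rcases e.symm y with _ | x
  · exact inner_zero_left _
  · exact inner_basisVec x f

theorem pullback_ofSet_apply (t : Set X) [DecidablePred (· ∈ t)] (f : EllTwo X) (x : X) :
    pullback (PEquiv.ofSet t) f x = if x ∈ t then f x else 0 := by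
  change (if x ∈ t then some x else none).elim 0 f = _
  split_ifs <;> rfl

theorem pullback_mul_star_apply (e : X ≃. X) (f : EllTwo X) (x : X) :
    (pullback e * star (pullback e)) f x = if (e x).isSome then f x else 0 := by
  rw [star_pullback, pullback_mul, PEquiv.self_trans_symm, pullback_ofSet_apply]
  rfl

theorem star_pullback_mul_apply (e : X ≃. X) (f : EllTwo X) (x : X) :
    (star (pullback e) * pullback e) f x = if (e.symm x).isSome then f x else 0 := by
  simpa only [star_pullback, PEquiv.symm_symm] using pullback_mul_star_apply e.symm f x

end Pullback

/-! ### The orbit representation -/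

/-- The shift `x₀ x₁ x₂ … ↦ x₁ x₂ …` on `Λ_A`. -/
def shift (x : Subshift A) : Subshift A := ⟨fun n => x.1 (n + 1), fun n => x.2 (n + 1)⟩

theorem shift_prepend (i : Fin d) (x : Subshift A) (h : A i (x.1 0) = 1) :
    shift (prepend i x h) = x := rfl

theorem prepend_shift (x : Subshift A) : prepend (x.1 0) (shift x) (x.2 0) = x :=
  Subtype.ext (funext fun n => by cases n <;> rfl)

theorem initWord_succ_eq_cons (x : Subshift A) (n : ℕ) :
    initWord x.1 (n + 1) = x.1 0 :: initWord (shift x).1 n := by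
  rw [← initWord_prepend (x.1 0) (shift x) (x.2 0), prepend_shift]

variable (A) in
/-- The partial bijection `(x, k) ↦ (shift x, k - 1)` with domain the cylinder `x₀ = i`. The second
coordinate counts letters, so that only words of equal length contribute to the diagonal matrix
coefficients of the orbit representation. -/
def orbitShift (i : Fin d) : (Subshift A × ℤ) ≃. (Subshift A × ℤ) where
  toFun p := if p.1.1 0 = i then some (shift p.1, p.2 - 1) else none
  invFun q := if h : A i (q.1.1 0) = 1 then some (prepend i q.1 h, q.2 + 1) else none
  inv p q := by
    constructor
    · intro hq
      split_ifs at hq with h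
      obtain rfl := Option.some.inj hq
      simp [shift_prepend, show (prepend i q.1 h).1 0 = i from rfl]
    · intro hp
      split_ifs at hp with h
      obtain rfl := Option.some.inj hp
      subst h
      exact (dif_pos (p.1.2 0)).trans
        (congrArg some (Prod.ext (prepend_shift _) (sub_add_cancel _ _)))

theorem orbitShift_apply (i : Fin d) (p : Subshift A × ℤ) :
    orbitShift A i p = if p.1.1 0 = i then some (shift p.1, p.2 - 1) else none := rfl

theorem orbitShift_symm_apply (i : Fin d) (q : Subshift A × ℤ) :
    (orbitShift A i).symm q =
      if h : A i (q.1.1 0) = 1 then some (prepend i q.1 h, q.2 + 1) else none := rfl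

theorem orbitShift_range_apply (i : Fin d) (f : EllTwo (Subshift A × ℤ)) (p : Subshift A × ℤ) :
    (pullback (orbitShift A i) * star (pullback (orbitShift A i))) f p =
      if p.1.1 0 = i then f p else 0 := by
  rw [pullback_mul_star_apply, orbitShift_apply]
  split_ifs <;> simp_all

theorem isCKFamily_pullback (hA01 : ∀ i j, A i j = 0 ∨ A i j = 1) :
    IsCKFamily A fun i => pullback (orbitShift A i) where
  partial_isometry i := by
    ext f p
    refine (orbitShift_range_apply i _ p).trans (ite_eq_left_iff.2 fun h => ?_)
    change 0 = (orbitShift A i p).elim 0 f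
    rw [orbitShift_apply, if_neg h, Option.elim_none]
  sum_range := by
    ext f p
    rw [sum_apply, lp.coeFn_sum, Finset.sum_apply]
    simp only [orbitShift_range_apply]
    simp
  source i := by
    ext f p
    have hsum : (∑ j, A i j • (pullback (orbitShift A j) * star (pullback (orbitShift A j)))) f p
        = ∑ j, A i j • if p.1.1 0 = j then f p else 0 := by
      simp only [← orbitShift_range_apply]
      rw [sum_apply, lp.coeFn_sum, Finset.sum_apply]
      rfl
    rw [hsum, star_pullback_mul_apply, orbitShift_symm_apply]
    obtain h | h := hA01 i (p.1.1 0) <;> simp [h]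

namespace CKAlgebra

variable (hA01 : ∀ i j, A i j = 0 ∨ A i j = 1)

/-- The representation of `O_A` on `ℓ²(Λ_A × ℤ)` with `s i δ(x, k) = δ(i x, k + 1)` if `i` can
precede `x`, and `0` otherwise. -/
def orbitRep : CKAlgebra A →⋆ₐ[ℂ] (EllTwo (Subshift A × ℤ) →L[ℂ] EllTwo (Subshift A × ℤ)) :=
  lift (isCKFamily_pullback hA01)

theorem orbitRep_s (i : Fin d) : orbitRep hA01 (s A i) = pullback (orbitShift A i) := lift_s _ i

theorem orbitRep_mul_apply (b c : CKAlgebra A) (f : EllTwo (Subshift A × ℤ)) :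
    orbitRep hA01 (b * c) f = orbitRep hA01 b (orbitRep hA01 c f) := by
  rw [map_mul]
  rfl

theorem norm_orbitRep_apply_le (b : CKAlgebra A) (p q : Subshift A × ℤ) :
    ‖orbitRep hA01 b (basisVec q) p‖ ≤ ‖b‖ :=
  calc ‖orbitRep hA01 b (basisVec q) p‖
      ≤ ‖orbitRep hA01 b (basisVec q)‖ := lp.norm_apply_le_norm (by norm_num) _ _
    _ ≤ ‖orbitRep hA01 b‖ * ‖basisVec q‖ := (orbitRep hA01 b).le_opNorm _
    _ ≤ ‖b‖ := by
      rw [norm_basisVec, mul_one]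
      exact NonUnitalStarAlgHom.norm_apply_le (orbitRep hA01) b

/-- The matrix coefficient `⟨δ_p, b δ_q⟩` of `b` in the orbit representation. -/
def coef (p q : Subshift A × ℤ) : CKAlgebra A →L[ℂ] ℂ :=
  LinearMap.mkContinuous
    { toFun b := orbitRep hA01 b (basisVec q) p
      map_add' b c := by rw [map_add]; rfl
      map_smul' r b := by rw [map_smul]; rfl }
    1 fun b => (norm_orbitRep_apply_le hA01 b p q).trans_eq (one_mul _).symm

theorem coef_apply (p q : Subshift A × ℤ) (b : CKAlgebra A) :
    coef hA01 p q b = orbitRep hA01 b (basisVec q) p := rfl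

theorem coef_star (p q : Subshift A × ℤ) (b : CKAlgebra A) :
    coef hA01 p q (star b) = star (coef hA01 q p b) := by
  rw [coef_apply, coef_apply, map_star, ← inner_basisVec, ← inner_basisVec,
    ContinuousLinearMap.star_eq_adjoint, ContinuousLinearMap.adjoint_inner_right]
  exact (inner_conj_symm _ _).symm

open scoped ComplexOrder in
theorem coef_star_mul_self_nonneg (p : Subshift A × ℤ) (b : CKAlgebra A) :
    0 ≤ coef hA01 p p (star b * b) := by
  rw [coef_apply, orbitRep_mul_apply, map_star, ← inner_basisVec,
    ContinuousLinearMap.star_eq_adjoint, ContinuousLinearMap.adjoint_inner_right,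
    inner_self_eq_norm_sq_to_K, ← RCLike.ofReal_pow]
  exact Complex.zero_le_real.2 (sq_nonneg _)

open scoped Classical in
theorem coef_one (p q : Subshift A × ℤ) : coef hA01 p q 1 = if p = q then 1 else 0 := by
  rw [coef_apply, map_one]
  exact (basisVec_apply q p).trans (by congr)

theorem coef_s_mul (i : Fin d) (p q : Subshift A × ℤ) (b : CKAlgebra A) :
    coef hA01 p q (s A i * b) = if p.1.1 0 = i then coef hA01 (shift p.1, p.2 - 1) q b else 0 := by
  rw [coef_apply, orbitRep_mul_apply, orbitRep_s, pullback_apply, orbitShift_apply]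
  split_ifs <;> rfl

theorem coef_star_s_mul (i : Fin d) (p q : Subshift A × ℤ) (b : CKAlgebra A) :
    coef hA01 p q (star (s A i) * b) =
      if h : A i (p.1.1 0) = 1 then coef hA01 (prepend i p.1 h, p.2 + 1) q b else 0 := by
  rw [coef_apply, orbitRep_mul_apply, map_star, orbitRep_s, star_pullback, pullback_apply,
    orbitShift_symm_apply]
  split_ifs <;> rfl

theorem coef_mul_s (i : Fin d) (p q : Subshift A × ℤ) (b : CKAlgebra A) :
    coef hA01 p q (b * s A i) =
      if h : A i (q.1.1 0) = 1 then coef hA01 p (prepend i q.1 h, q.2 + 1) b else 0 := by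
  rw [← star_star (b * s A i), coef_star, star_mul, coef_star_s_mul]
  split_ifs
  · rw [coef_star, star_star]
  · exact star_zero _

theorem coef_word_mul (w : List (Fin d)) (p q : Subshift A × ℤ) (b : CKAlgebra A) :
    coef hA01 p q (word A w * b) = if initWord p.1.1 w.length = w then
      coef hA01 (shift^[w.length] p.1, p.2 - w.length) q b else 0 := by
  induction w generalizing p with
  | nil => simp [word_nil, initWord]
  | cons i w ih =>
    simp only [word_cons, mul_assoc, coef_s_mul, ih, List.length_cons, initWord_succ_eq_cons,
      List.cons.injEq, Function.iterate_succ_apply, Nat.cast_succ, ite_and, sub_sub,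
      add_comm (1 : ℤ)]

open scoped Classical in
theorem coef_word_mul_star_word (v w : List (Fin d)) (p q : Subshift A × ℤ) :
    coef hA01 p q (word A v * star (word A w)) =
      if initWord p.1.1 v.length = v ∧ initWord q.1.1 w.length = w ∧
        shift^[v.length] p.1 = shift^[w.length] q.1 ∧ p.2 - v.length = q.2 - w.length
      then 1 else 0 := by
  rw [coef_word_mul, coef_star, ← mul_one (word A w), coef_word_mul, coef_one]
  simp only [Prod.mk.injEq, eq_comm (a := shift^[w.length] q.1), eq_comm (a := q.2 - w.length),
    apply_ite star, star_one, star_zero, ite_and]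

theorem coef_add_right (m k l : ℤ) (x y : Subshift A) (b : CKAlgebra A) :
    coef hA01 (x, k + m) (y, l + m) b = coef hA01 (x, k) (y, l) b := by
  refine congrArg (· b) (ext_word (φ := coef hA01 (x, k + m) (y, l + m)) fun v w => ?_)
  classical
  rw [coef_word_mul_star_word, coef_word_mul_star_word]
  refine if_congr ?_ rfl rfl
  rw [add_sub_right_comm, add_sub_right_comm, add_left_inj]

theorem coef_diag_word (v w : List (Fin d)) (x : Subshift A) :
    coef hA01 (x, 0) (x, 0) (word A v * star (word A w)) =
      if v = w then cylinderIndicator A v x else 0 := by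
  rw [coef_word_mul_star_word, cylinderIndicator_apply, ← ite_and]
  refine ite_congr (propext ⟨fun ⟨hv, hw, _, hlen⟩ => ?_, ?_⟩) (fun _ => rfl) fun _ => rfl
  · have hlen : v.length = w.length := by simpa using hlen
    exact ⟨by rw [← hv, hlen, hw], hv⟩
  · rintro ⟨rfl, hv⟩
    exact ⟨hv, hv, rfl, rfl⟩

theorem coef_wordProj_mul (w : List (Fin d)) (p q : Subshift A × ℤ) (b : CKAlgebra A) :
    coef hA01 p q (wordProj A w * b) = cylinderIndicator A w p.1 * coef hA01 p q b := by
  induction w generalizing p b with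
  | nil => simp [wordProj_nil, cylinderIndicator_nil]
  | cons i w ih =>
    have hp : A (p.1.1 0) ((shift p.1).1 0) = 1 := p.1.2 0
    simp only [wordProj_cons, mul_assoc, coef_s_mul, ih, coef_star_s_mul]
    by_cases h : p.1.1 0 = i
    · subst h
      simp [cylinderIndicator_apply, initWord_succ_eq_cons, hp, prepend_shift]
    · simp [cylinderIndicator_apply, initWord_succ_eq_cons, h]

theorem coef_diagEmbedding_mul (f : C(Subshift A, ℂ)) (p q : Subshift A × ℤ) (b : CKAlgebra A) :
    coef hA01 p q (diagEmbedding A f * b) = f p.1 * coef hA01 p q b := by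
  induction f using cylinderIndicator_induction generalizing b with
  | closed =>
    simp only [ofPred_forall]
    exact isClosed_iInter fun b => isClosed_eq
      ((coef hA01 p q).continuous.comp (continuous_diagEmbedding.mul continuous_const))
      ((continuous_eval_const p.1).mul continuous_const)
  | algebraMap c =>
    rw [AlgHomClass.commutes, ← Algebra.smul_def, map_smul]
    rfl
  | cylinderIndicator w => rw [diagEmbedding_cylinderIndicator, coef_wordProj_mul]
  | add f g hf hg => rw [map_add, add_mul, map_add, hf, hg, ContinuousMap.add_apply, add_mul]
  | mul f g hf hg =>
    rw [map_mul (diagEmbedding A), mul_assoc, hf, hg, ContinuousMap.mul_apply, mul_assoc]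

theorem coef_mul_diagEmbedding (f : C(Subshift A, ℂ)) (p q : Subshift A × ℤ) (b : CKAlgebra A) :
    coef hA01 p q (b * diagEmbedding A f) = f q.1 * coef hA01 p q b := by
  rw [← star_star (b * diagEmbedding A f), coef_star, star_mul,
    ← map_star (diagEmbedding A), coef_diagEmbedding_mul, coef_star, star_mul', star_star,
    ContinuousMap.star_apply, star_star]

/-! ### The conditional expectation onto `C(Λ_A)` -/

theorem continuous_coef_diag (b : CKAlgebra A) :
    Continuous fun x : Subshift A => coef hA01 (x, 0) (x, 0) b := by
  have hspan : ∀ c ∈ wordSpan A, Continuous fun x : Subshift A => coef hA01 (x, 0) (x, 0) c := by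
    intro c hc
    induction hc using Submodule.span_induction with
    | mem c hc =>
      obtain ⟨⟨v, w⟩, rfl⟩ := hc
      simp only [coef_diag_word]
      split_ifs
      exacts [(cylinderIndicator A v).continuous, continuous_const]
    | zero => simpa only [map_zero] using continuous_const
    | add c c' _ _ hc hc' => simp only [map_add]; exact hc.add hc'
    | smul r c _ hc => simp only [map_smul]; exact hc.const_smul r
  refine continuous_of_uniform_approx_of_continuous fun u hu => ?_
  obtain ⟨ε, hε, hu⟩ := Metric.mem_uniformity_dist.1 hu
  obtain ⟨c, hc, hbc⟩ := Metric.mem_closure_iff.1 (dense_wordSpan b) ε hε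
  refine ⟨_, hspan c hc, fun x => hu ?_⟩
  rw [dist_eq_norm, ← map_sub]
  exact (norm_orbitRep_apply_le hA01 _ _ _).trans_lt (by rwa [← dist_eq_norm])

/-- The conditional expectation of `O_A` onto `C(Λ_A)`, given by the diagonal matrix coefficients
of the orbit representation. -/
def expectation : CKAlgebra A →L[ℂ] C(Subshift A, ℂ) :=
  LinearMap.mkContinuous
    { toFun b := ⟨fun x => coef hA01 (x, 0) (x, 0) b, continuous_coef_diag hA01 b⟩
      map_add' b c := by ext x; exact map_add (coef hA01 (x, 0) (x, 0)) b c
      map_smul' r b := by ext x; exact map_smul (coef hA01 (x, 0) (x, 0)) r b }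
    1 fun b => by
      rw [one_mul]
      exact (ContinuousMap.norm_le _ (norm_nonneg b)).2 fun x => norm_orbitRep_apply_le hA01 b _ _

theorem expectation_apply (b : CKAlgebra A) (x : Subshift A) :
    expectation hA01 b x = coef hA01 (x, 0) (x, 0) b := rfl

theorem expectation_diagEmbedding_mul (f : C(Subshift A, ℂ)) (b : CKAlgebra A) :
    expectation hA01 (diagEmbedding A f * b) = f * expectation hA01 b := by
  ext x
  exact coef_diagEmbedding_mul hA01 f _ _ b

theorem expectation_mul_diagEmbedding (f : C(Subshift A, ℂ)) (b : CKAlgebra A) :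
    expectation hA01 (b * diagEmbedding A f) = f * expectation hA01 b := by
  ext x
  exact coef_mul_diagEmbedding hA01 f _ _ b

theorem expectation_diagEmbedding (f : C(Subshift A, ℂ)) :
    expectation hA01 (diagEmbedding A f) = f := by
  ext x
  simpa [expectation_apply, coef_one] using coef_diagEmbedding_mul hA01 f (x, 0) (x, 0) 1

theorem expectation_mul_s (i : Fin d) (b : CKAlgebra A) :
    expectation hA01 (b * s A i) = branch i (expectation hA01 (s A i * b)) := by
  ext x
  rw [expectation_apply, coef_mul_s, branch_apply]
  refine dite_congr rfl (fun h => ?_) fun _ => rfl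
  rw [expectation_apply, coef_s_mul, if_pos (by rfl), shift_prepend]
  change coef hA01 (x, 0) (prepend i x h, 0 + 1) b = coef hA01 (x, 0 - 1) (prepend i x h, 0) b
  rw [← coef_add_right hA01 1 (0 - 1) 0, sub_add_cancel]

theorem branch_mul_expectation_s_mul {i j : Fin d} (hij : j ≠ i) (f : C(Subshift A, ℂ))
    (b : CKAlgebra A) : branch j (f * expectation hA01 (s A i * b)) = 0 := by
  ext x
  rw [branch_apply]
  split_ifs with h
  · rw [ContinuousMap.mul_apply, expectation_apply, coef_s_mul, if_neg (by exact hij), mul_zero,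
      ContinuousMap.zero_apply]
  · rfl

variable (μ : ProbabilityMeasure (Subshift A))

/-- The functional `μ ∘ E` on `O_A`, where `E` is the expectation onto the diagonal. -/
def measureState : CKAlgebra A →L[ℂ] ℂ :=
  (integralCLM (μ : Measure (Subshift A))).comp (expectation hA01)

theorem measureState_diagEmbedding (f : C(Subshift A, ℂ)) :
    measureState hA01 μ (diagEmbedding A f) = integralCLM (μ : Measure (Subshift A)) f :=
  congrArg (integralCLM (μ : Measure (Subshift A))) (expectation_diagEmbedding hA01 f)

open scoped ComplexOrder in
theorem isState_measureState : IsState (measureState hA01 μ) where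
  map_one := by
    rw [← map_one (diagEmbedding A), measureState_diagEmbedding, integralCLM_apply]
    simp
  nonneg b := integral_nonneg fun x => coef_star_mul_self_nonneg hA01 _ b

variable {a : selfAdjoint C(Subshift A, ℂ)} {β : ℝ}

theorem integralCLM_sum_branch (μ : eigenmeasures a β) (f : C(Subshift A, ℂ)) :
    integralCLM (μ.1 : Measure (Subshift A)) (∑ i, branch i (phaseExt a β I * f)) =
      integralCLM (μ.1 : Measure (Subshift A)) f := by
  have heigen : integralCLM (μ.1 : Measure (Subshift A)) (ruelle a.1 f) = _ := μ.2 f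
  rw [ruelle_eq_sum_branch, map_smul, smul_eq_mul] at heigen
  exact mul_left_cancel₀ (ofReal_ne_zero.2 (Real.exp_ne_zero β)) heigen

theorem isConformal_measureState (μ : eigenmeasures a β) :
    IsConformal a β (measureState hA01 μ.1) where
  apply_mul_s i b := by
    have hsum : branch i (expectation hA01 (s A i * (b * diagEmbedding A (phaseExt a β I)))) =
        ∑ j, branch j (phaseExt a β I * expectation hA01 (s A i * b)) := by
      rw [Finset.sum_eq_single i (fun j _ hj => branch_mul_expectation_s_mul hA01 hj _ _) (by simp),
        ← mul_assoc, expectation_mul_diagEmbedding]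
    change integralCLM _ (expectation hA01 _) = integralCLM _ (expectation hA01 _)
    rw [expectation_mul_s, hsum, integralCLM_sum_branch]
  apply_comm f b := by
    change integralCLM _ (expectation hA01 _) = integralCLM _ (expectation hA01 _)
    rw [expectation_mul_diagEmbedding, expectation_diagEmbedding_mul]

end CKAlgebra

/-! ### Growth of the iterates of the Ruelle operator -/

section
attribute [local instance] Matrix.linftyOpNormedRing Matrix.linftyOpNormedAlgebra

theorem specRadius_pow_le [Nonempty (Fin d)] (n : ℕ) :
    specRadius A ^ n ≤ ∑ i, ∑ j, ((A ^ n) i j : ℝ) := by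
  set M : Matrix (Fin d) (Fin d) ℂ := A.map (Nat.cast : ℕ → ℂ)
  have hpow : M ^ n = (A ^ n).map (Nat.cast : ℕ → ℂ) :=
    (map_pow (Nat.castRingHom ℂ).mapMatrix A n).symm
  have hspec : spectralRadius ℂ M ^ n ≤ (‖M ^ n‖₊ : ENNReal) :=
    (spectrum.spectralRadius_pow_le' M n).trans (spectrum.spectralRadius_le_nnnorm _)
  have hnorm : ‖M ^ n‖₊ ≤ ∑ i, ∑ j, ((A ^ n) i j : NNReal) := by
    rw [Matrix.linfty_opNNNorm_def]
    refine Finset.sup_le fun i hi => ?_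
    simp only [hpow, Matrix.map_apply, nnnorm_natCast]
    exact Finset.single_le_sum (f := fun i => ∑ j, ((A ^ n) i j : NNReal))
      (fun _ _ => bot_le) hi
  calc specRadius A ^ n = (spectralRadius ℂ M ^ n).toReal := (ENNReal.toReal_pow _ _).symm
    _ ≤ ‖M ^ n‖ := ENNReal.toReal_mono ENNReal.coe_ne_top hspec
    _ ≤ ∑ i, ∑ j, ((A ^ n) i j : ℝ) := by exact_mod_cast hnorm

end

theorem le_of_forall_pow_le_mul_pow {x y C : ℝ} (hy : 0 < y) (h : ∀ n : ℕ, x ^ n ≤ C * y ^ n) :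
    x ≤ y := by
  by_contra! hlt
  obtain ⟨n, hn⟩ := pow_unbounded_of_one_lt C ((one_lt_div hy).2 hlt)
  rw [div_pow, lt_div_iff₀ (pow_pos hy n)] at hn
  exact hn.not_ge (h n)

section

variable {a : selfAdjoint C(Subshift A, ℂ)} {β m : ℝ}

open scoped ComplexOrder in
theorem exp_mul_sum_pow_le_ruelle_iterate (hA01 : ∀ i j, A i j = 0 ∨ A i j = 1)
    (hm : ∀ x, m ≤ (a.1 x).re) (n : ℕ) (x : Subshift A) :
    ((Real.exp m ^ n * ∑ i, ((A ^ n) i (x.1 0) : ℝ) : ℝ) : ℂ) ≤ ((ruelle a.1)^[n] 1) x := by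
  induction n generalizing x with
  | zero => simp [Matrix.one_apply]
  | succ n ih =>
    have hsplit : Real.exp m ^ (n + 1) * ∑ i, ((A ^ (n + 1)) i (x.1 0) : ℝ) =
        ∑ k, (A k (x.1 0) : ℝ) * (Real.exp m * (Real.exp m ^ n * ∑ i, ((A ^ n) i k : ℝ))) := by
      simp only [pow_succ A, Matrix.mul_apply, Nat.cast_sum, Nat.cast_mul]
      rw [Finset.sum_comm, Finset.mul_sum]
      refine Finset.sum_congr rfl fun k _ => ?_
      rw [← Finset.sum_mul]
      ring
    rw [hsplit, ofReal_sum, Function.iterate_succ_apply']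
    refine Finset.sum_le_sum fun k _ => ?_
    split_ifs with h
    · have hexp : exp (a.1 (prepend k x h)) = (Real.exp (a.1 (prepend k x h)).re : ℂ) := by
        rw [ofReal_exp, conj_eq_iff_re.1 (CKAlgebra.conj_selfAdjoint_apply a _)]
      rw [h, Nat.cast_one, one_mul, ofReal_mul, hexp]
      refine mul_le_mul (real_le_real.2 (Real.exp_le_exp.2 (hm _))) (ih (prepend k x h)) ?_ ?_ <;>
        exact zero_le_real.2 (by positivity)
    · simp [(hA01 k (x.1 0)).resolve_right h]

theorem integral_ruelle_iterate (μ : eigenmeasures a β) (n : ℕ) :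
    ∫ x, ((ruelle a.1)^[n] 1) x ∂(μ.1 : Measure (Subshift A)) = (Real.exp β ^ n : ℂ) := by
  induction n with
  | zero => simp
  | succ n ih => rw [Function.iterate_succ_apply', μ.2, ih, pow_succ']

theorem integrable_sum_pow (μ : Measure (Subshift A)) [IsFiniteMeasure μ] (n : ℕ) :
    Integrable (fun x : Subshift A => ∑ i, ((A ^ n) i (x.1 0) : ℝ)) μ := by
  have hcont : Continuous fun x : Subshift A => ∑ i, ((A ^ n) i (x.1 0) : ℝ) :=
    (continuous_of_discreteTopology (f := fun k => ∑ i, ((A ^ n) i k : ℝ))).comp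
      ((continuous_apply 0).comp continuous_subtype_val)
  exact hcont.integrable_of_hasCompactSupport (.of_compactSpace _)

theorem integral_sum_pow_le (hA01 : ∀ i j, A i j = 0 ∨ A i j = 1) (μ : eigenmeasures a β)
    (hm : ∀ x, m ≤ (a.1 x).re) (n : ℕ) :
    ∫ x, ∑ i, ((A ^ n) i (x.1 0) : ℝ) ∂(μ.1 : Measure (Subshift A)) ≤ Real.exp (β - m) ^ n := by
  have hint := integrable_continuousMap (μ.1 : Measure (Subshift A)) ((ruelle a.1)^[n] 1)
  have hre : ∫ x, (((ruelle a.1)^[n] 1) x).re ∂(μ.1 : Measure (Subshift A)) = Real.exp β ^ n := by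
    refine (integral_re hint).trans ?_
    rw [integral_ruelle_iterate, ← ofReal_pow]
    exact ofReal_re _
  rw [Real.exp_sub, div_pow, le_div_iff₀' (by positivity), ← integral_const_mul, ← hre]
  exact integral_mono ((integrable_sum_pow _ n).const_mul _) hint.re fun x =>
    (le_def.1 (exp_mul_sum_pow_le_ruelle_iterate hA01 hm n x)).1

theorem specRadius_pow_le_sum_pow_add {N : Fin d → Fin d → ℕ}
    (hN : ∀ i j, 0 < (A ^ N i j) i j) (n : ℕ) (l : Fin d) :
    specRadius A ^ n ≤ ∑ j, ∑ k, ∑ i, ((A ^ (n + N j k)) i l : ℝ) := by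
  have : Nonempty (Fin d) := ⟨l⟩
  refine (specRadius_pow_le n).trans (Finset.sum_comm.trans_le ?_)
  refine Finset.sum_le_sum fun j _ => le_trans (Finset.sum_le_sum fun i _ => ?_)
    (Finset.single_le_sum (f := fun k => ∑ i, ((A ^ (n + N j k)) i l : ℝ))
      (fun _ _ => by positivity) (Finset.mem_univ l))
  rw [pow_add, Matrix.mul_apply]
  exact_mod_cast (Nat.le_mul_of_pos_right _ (hN j l)).trans
    (Finset.single_le_sum (f := fun k => (A ^ n) i k * (A ^ N j l) k l)
      (fun _ _ => Nat.zero_le _) (Finset.mem_univ j))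

theorem specRadius_le_exp (hA01 : ∀ i j, A i j = 0 ∨ A i j = 1)
    (hirr : ∀ i j, ∃ n, 0 < (A ^ n) i j) (μ : eigenmeasures a β) (hm : ∀ x, m ≤ (a.1 x).re) :
    specRadius A ≤ Real.exp (β - m) := by
  choose N hN using hirr
  refine le_of_forall_pow_le_mul_pow (C := ∑ j, ∑ k, Real.exp (β - m) ^ N j k)
    (Real.exp_pos _) fun n => ?_
  have hint := fun j k => integrable_sum_pow (μ.1 : Measure (Subshift A)) (n + N j k)
  calc specRadius A ^ n = ∫ _, specRadius A ^ n ∂(μ.1 : Measure (Subshift A)) := by simp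
    _ ≤ ∫ x, ∑ j, ∑ k, ∑ i, ((A ^ (n + N j k)) i (x.1 0) : ℝ) ∂(μ.1 : Measure (Subshift A)) :=
      integral_mono (integrable_const _)
        (integrable_finsetSum _ fun j _ => integrable_finsetSum _ fun k _ => hint j k)
        fun x => specRadius_pow_le_sum_pow_add hN n (x.1 0)
    _ = ∑ j, ∑ k, ∫ x, ∑ i, ((A ^ (n + N j k)) i (x.1 0) : ℝ) ∂(μ.1 : Measure (Subshift A)) := by
      rw [integral_finsetSum _ fun j _ => integrable_finsetSum _ fun k _ => hint j k]
      exact Finset.sum_congr rfl fun j _ => integral_finsetSum _ fun k _ => hint j k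
    _ ≤ ∑ j, ∑ k, Real.exp (β - m) ^ (n + N j k) :=
      Finset.sum_le_sum fun j _ => Finset.sum_le_sum fun k _ => integral_sum_pow_le hA01 μ hm _
    _ = (∑ j, ∑ k, Real.exp (β - m) ^ N j k) * Real.exp (β - m) ^ n := by
      simp_rw [Finset.sum_mul, ← pow_add, add_comm n]

theorem norm_phaseExt_I_lt_one (hA01 : ∀ i j, A i j = 0 ∨ A i j = 1)
    (hirr : ∀ i j, ∃ n, 0 < (A ^ n) i j) (μ : eigenmeasures a β)
    (hvar : var₀ a.1 < Real.log (specRadius A)) : ‖CKAlgebra.phaseExt a β I‖ < 1 := by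
  obtain ⟨x₀⟩ : Nonempty (Subshift A) := μ.1.nonempty
  have hrange : IsCompact (range fun x => (a.1 x).re) :=
    isCompact_range (continuous_re.comp a.1.continuous)
  have hsup : ∀ x, (a.1 x).re ≤ ⨆ y, (a.1 y).re := le_ciSup hrange.bddAbove
  have hinf : ∀ x, ⨅ y, (a.1 y).re ≤ (a.1 x).re := ciInf_le hrange.bddBelow
  have hvar_nonneg : 0 ≤ var₀ a.1 := sub_nonneg.2 ((hinf x₀).trans (hsup x₀))
  have hpos : 0 < specRadius A := by
    have hnonneg : 0 ≤ specRadius A := ENNReal.toReal_nonneg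
    refine hnonneg.lt_of_ne' fun h => hvar.not_ge ?_
    rwa [h, Real.log_zero]
  have hlog := (Real.log_le_iff_le_exp hpos).2 (specRadius_le_exp hA01 hirr μ hinf)
  have hmax : ⨆ y, (a.1 y).re < β := by
    rw [var₀] at hvar
    linarith
  refine ((ContinuousMap.norm_le _ (Real.exp_nonneg _)).2 fun x => ?_).trans_lt
    (Real.exp_lt_one_iff.2 (sub_neg.2 hmax))
  rw [CKAlgebra.phaseExt_I_apply, norm_exp, sub_re, ofReal_re]
  exact Real.exp_le_exp.2 (sub_le_sub_right (hsup x) β)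

end

/-! ### The restriction map -/

namespace CKAlgebra

open scoped ComplexOrder in
theorem isState_comp_diagCLM {ω : CKAlgebra A →L[ℂ] ℂ} (hω : IsState ω) :
    IsState (ω.comp (diagCLM A)) where
  map_one := (congrArg ω (map_one (diagEmbedding A))).trans hω.map_one
  nonneg f := by
    have hmap : diagCLM A (star f * f) = star (diagEmbedding A f) * diagEmbedding A f := by
      rw [← map_star, ← map_mul]
      rfl
    rw [ContinuousLinearMap.comp_apply, hmap]
    exact hω.nonneg _

end CKAlgebra

theorem exists_eigenmeasure {a : selfAdjoint C(Subshift A, ℂ)} {β : ℝ}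
    (hA01 : ∀ i j, A i j = 0 ∨ A i j = 1) (ω : kmsStates a β) :
    ∃ μ : eigenmeasures a β, ∀ f : C(Subshift A, ℂ),
      ω.1 (CKAlgebra.diagEmbedding A f) = ∫ x, f x ∂(μ.1 : Measure (Subshift A)) := by
  obtain ⟨μ, hμ⟩ := (CKAlgebra.isState_comp_diagCLM ω.2.isState).exists_measure
  have hrestrict : ∀ f : C(Subshift A, ℂ), ω.1 (CKAlgebra.diagEmbedding A f) =
      ∫ x, f x ∂(μ : Measure (Subshift A)) := DFunLike.congr_fun hμ
  refine ⟨⟨μ, fun f => ?_⟩, hrestrict⟩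
  rw [← hrestrict, ← hrestrict,
    (CKAlgebra.isConformal_of_isKMSState ω.2).apply_ruelle hA01]

end CuntzKrieger

end

open CuntzKrieger CKAlgebra in
theorem proposition7p6_general {d : ℕ} {A : Matrix (Fin d) (Fin d) ℕ}
    (hA01 : ∀ i j, A i j = 0 ∨ A i j = 1) (a : selfAdjoint C(Subshift A, ℂ)) (β : ℝ) :
    ∃ Φ : kmsStates a β → eigenmeasures a β,
      (∀ (ω : kmsStates a β) (f : C(Subshift A, ℂ)),
        ω.1 (diagEmbedding A f) =
          ∫ x, f x ∂((Φ ω).1 : MeasureTheory.Measure (Subshift A))) ∧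
      Function.Surjective Φ ∧
      ((∀ i j, ∃ n, 0 < (A ^ n) i j) → var₀ a.1 < Real.log (specRadius A) →
        Function.Bijective Φ) := by
  choose Φ hΦ using exists_eigenmeasure (a := a) (β := β) hA01
  have hsurj : Function.Surjective Φ := fun μ => by
    have hKMS := (isConformal_measureState hA01 μ).isKMSState (isState_measureState hA01 μ.1)
    refine ⟨⟨_, hKMS⟩, Subtype.ext (integralCLM_injective (ContinuousLinearMap.ext fun f => ?_))⟩
    exact (hΦ _ f).symm.trans (measureState_diagEmbedding hA01 μ.1 f)
  have hinj : (∀ i j, ∃ n, 0 < (A ^ n) i j) → var₀ a.1 < Real.log (specRadius A) →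
      Function.Injective Φ := fun hirr hvar ω ω' h =>
    Subtype.ext <| (isConformal_of_isKMSState ω.2).eq_of_diagEmbedding ω.2.isState
      (isConformal_of_isKMSState ω'.2) ω'.2.isState hA01
      (norm_phaseExt_I_lt_one hA01 hirr (Φ ω) hvar) fun f => by rw [hΦ, hΦ, h]
  exact ⟨Φ, hΦ, hsurj, fun hirr hvar => ⟨hinj hirr hvar, hsurj⟩⟩

theorem proposition7p6 {d : ℕ} (A : Matrix (Fin d) (Fin d) ℕ)
    (hA01 : ∀ i j, A i j = 0 ∨ A i j = 1) (hA : CuntzKrieger.IsAperiodic A)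
    (a : selfAdjoint C(CuntzKrieger.Subshift A, ℂ)) (β : ℝ) :
    ∃ Φ : CuntzKrieger.kmsStates a β → CuntzKrieger.eigenmeasures a β,
      (∀ (ω : CuntzKrieger.kmsStates a β) (f : C(CuntzKrieger.Subshift A, ℂ)),
        ω.1 (CuntzKrieger.CKAlgebra.diagEmbedding A f) =
          ∫ x, f x ∂((Φ ω).1 : MeasureTheory.Measure (CuntzKrieger.Subshift A))) ∧
      Function.Surjective Φ ∧
      (CuntzKrieger.var₀ a.1 < Real.log (CuntzKrieger.specRadius A) →
        Function.Bijective Φ) := by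
  obtain ⟨N, -, hN⟩ := hA
  obtain ⟨Φ, hΦ, hsurj, hbij⟩ := proposition7p6_general hA01 a β
  exact ⟨Φ, hΦ, hsurj, hbij fun i j => ⟨N, hN i j⟩⟩
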